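/- Consider a nonstationary episodic Markov decision process with horizon $H$, a finite state space of size $S$, an arbitrary (possibly infinite) action space, initial state law $d_1$, transition laws $T_t(s'\mid s,a)$ and random rewards $r_t$ whose law depends on $(t,s_t,a_t,s_{t+1})$, such that for all $t\le H$ and all $(s,a,s')$ the reward has mean in $[0,R_{\max}]$ and variance at most $\sigma^2$. Let $\pi$ (target) and $\mu$ (behavior) be policies, possibly time dependent, with action probabilities (or densities with respect to a common reference measure) $\pi_t(a\mid s)$, $\mu_t(a\mid s)$. Let $d_t^\pi,d_t^\mu$ be the induced distributions of the state at time $t$, let $v^\pi=\mathbb{E}_\pi\big[\sum_{t=1}^H r_t\big]$, and let $$\tau_a=\sup_{t,s,a}\frac{\pi_t(a\mid s)}{\mu_t(a\mid s)},\qquad \tau_s=\max_{t,s}\frac{d_t^\pi(s)}{d_t^\mu(s)}\qquad (0/0:=0),$$ where $\pi_t(a\mid s)=0$ whenever $\mu_t(a\mid s)=0$ and $\tau_a<\infty$. From $n\ge 1$ independent episodes $(s_t^{(i)},a_t^{(i)},r_t^{(i)})$ collected with $\mu$, put $\rho_t^{(i)}=\pi_t(a_t^{(i)}\mid s_t^{(i)})/\mu_t(a_t^{(i)}\mid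 s_t^{(i)})$, $n_{t,s}=\#\{i: s_t^{(i)}=s\}$ and $$\widehat P_t(s'\mid s)=\frac1{n_{t,s}}\sum_{i}\rho_t^{(i)}\mathbf 1(s_t^{(i)}=s,\,s_{t+1}^{(i)}=s'),\qquad \widehat r_t(s)=\frac1{n_{t,s}}\sum_i\rho_t^{(i)}r_t^{(i)}\mathbf 1(s_t^{(i)}=s)$$ (both $0$ if $n_{t,s}=0$), $\widehat d_1(s)=n_{1,s}/n$, $\widehat d_{t+1}(s')=\sum_s\widehat P_t(s'\mid s)\widehat d_t(s)$. The marginalized importance sampling estimator is $\widehat v=\sum_{t=1}^H\sum_s\widehat d_t(s)\widehat r_t(s)$, and $\mathcal P\widehat v$ is its projection to $[0,HR_{\max}]$. Assume that for all $t=2,\dots,H$ $$n>\max\left\{\frac{4t\,\tau_a\tau_s}{\min_{t',s}\max\{d_{t'}^\pi(s),d_{t'}^\mu(s)\}},\ \frac{16\log n}{\min_{t',s}d_{t'}^\mu(s)}\right\},$$ where the minima are over all $t'\in\{1,\dots,H\}$ and states $s$ with $d_{t'}^\pi(s)>0$. Then there is a universal constant $C$ (in particular independent of the numbers of states and actions)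 such that $(\mathcal P\widehat v-v^\pi)^2$ is integrable and: 1. $\displaystyle \mathbb{E}\big[(\mathcal P\widehat v-v^\pi)^2\big]\le \frac{C}{n}\,H(\tau_a\tau_s+\tau_a)\,(\sigma^2+H^2R_{\max}^2).$ 2. $\displaystyle \mathbb{E}\big[(\mathcal P\widehat v-v^\pi)^2\big]\le \frac{C}{n}\,H^3\tau_a\tau_s\,(\sigma^2+R_{\max}^2).$ 3. If the action space is finite of size $A$ and $\mu$ visits every state-action pair with probability of order at least $1/(SA)$, that is, $d_t^\mu(s)\mu_t(a\mid s)\ge c/(SA)$ for some $c>0$ and all $t\le H$, $s$, $a$, then for every $\varepsilon>0$ the inequality $\displaystyle n\ge \frac{C\,H^3SA\,(\sigma^2+R_{\max}^2)}{c\,\varepsilon^2}$ implies $\mathbb{E}\big[(\mathcal P\widehat v-v^\pi)^2\big]\le\varepsilon^2$. -/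

import Mathlib

open MeasureTheory ProbabilityTheory

noncomputable section

namespace MIS

/-- A nonstationary episodic Markov decision process. Time is counted from `0`, so an episode of
horizon `H` uses the transition and reward laws at times `0, …, H - 1`. Given the state `s`, the
action `a` and the next state `s'` at time `t`, the (random) reward has law `reward t (s, a, s')`. -/
structure EpisodicMDP (S A : Type*) [MeasurableSpace S] [MeasurableSpace A] where
  init : Measure S
  trans : ℕ → Kernel (S × A) S
  reward : ℕ → Kernel (S × A × S) ℝ
  init_prob : IsProbabilityMeasure init
  trans_markov : ∀ t, IsMarkovKernel (trans t)
  reward_markov : ∀ t, IsMarkovKernel (reward t)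

attribute [instance] EpisodicMDP.init_prob EpisodicMDP.trans_markov EpisodicMDP.reward_markov

/-- A policy, given by the densities `dens t s a` of the action at time `t` in state `s` with
respect to a reference measure `ν` on actions. For `ν` the counting measure the densities are
probability mass functions; other choices of `ν` cover continuous action spaces. -/
structure Policy (S A : Type*) [MeasurableSpace A] (ν : Measure A) where
  dens : ℕ → S → A → ℝ
  measurable_dens : ∀ t s, Measurable (dens t s)
  dens_nonneg : ∀ t s a, 0 ≤ dens t s a
  lintegral_dens : ∀ t s, ∫⁻ a, ENNReal.ofReal (dens t s a) ∂ν = 1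

/-- An episode of length `h`: the states at times `0, …, h` (the last one being the state reached
after the last action), and the actions and rewards at times `0, …, h - 1`. -/
abbrev Traj (S A : Type*) (h : ℕ) : Type _ := (Fin (h + 1) → S) × (Fin h → A × ℝ)

section Rollout

variable {S A : Type*} [Fintype S] [MeasurableSpace S] [DiscreteMeasurableSpace S]
  [MeasurableSpace A] {ν : Measure A}

/-- The law of the action at time `t`, as a kernel from states to actions. -/
def Policy.kernel (p : Policy S A ν) (t : ℕ) : Kernel S A where
  toFun s := ν.withDensity fun a => ENNReal.ofReal (p.dens t s a)
  measurable' := Measurable.of_discrete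

instance (p : Policy S A ν) (t : ℕ) : IsMarkovKernel (p.kernel t) :=
  ⟨fun s => ⟨by simp [Policy.kernel, p.lintegral_dens t s]⟩⟩

/-- One step of the process at time `t`: from the state `s`, the law of `((a, s'), r)`. -/
def step (M : EpisodicMDP S A) (p : Policy S A ν) (t : ℕ) : Kernel S ((A × S) × ℝ) :=
  (p.kernel t ⊗ₖ M.trans t) ⊗ₖ M.reward t

/-- Append one step to an episode. -/
def appendStep {h : ℕ} (x : Traj S A h × ((A × S) × ℝ)) : Traj S A (h + 1) :=
  (Fin.snoc (α := fun _ => S) x.1.1 x.2.1.2,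
    Fin.snoc (α := fun _ => A × ℝ) x.1.2 (x.2.1.1, x.2.2))

/-- The law of the first `h` steps of an episode of `M` rolled out with the policy `p`. -/
def rollout (M : EpisodicMDP S A) (p : Policy S A ν) : (h : ℕ) → Measure (Traj S A h)
  | 0 => M.init.map fun s => (fun _ => s, Fin.elim0)
  | h + 1 =>
    ((rollout M p h) ⊗ₘ
      (step M p h).comap (fun τ : Traj S A h => τ.1 (Fin.last h)) (by fun_prop)).map appendStep

/-- `d_t(s)`: the probability of being in state `s` at time `t` under the policy `p`. -/
def stateDist (M : EpisodicMDP S A) (p : Policy S A ν) (t : ℕ) (s : S) : ℝ :=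
  (rollout M p t).real {τ | τ.1 (Fin.last t) = s}

/-- The value of `p`: the expected total reward of an episode of horizon `H`. -/
def value (M : EpisodicMDP S A) (p : Policy S A ν) (H : ℕ) : ℝ :=
  ∫ τ, ∑ t, (τ.2 t).2 ∂(rollout M p H)

/-- For all times before the horizon, the reward given `(s, a, s')` has finite second moment, mean
in `[0, Rmax]` and variance at most `σ ^ 2`. -/
def BoundedRewards (M : EpisodicMDP S A) (H : ℕ) (Rmax σ : ℝ) : Prop :=
  ∀ t < H, ∀ s a s', MemLp id 2 (M.reward t (s, a, s')) ∧
    ∫ r, r ∂(M.reward t (s, a, s')) ∈ Set.Icc 0 Rmax ∧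
    variance id (M.reward t (s, a, s')) ≤ σ ^ 2

/-- The importance weight `π(a|s) / μ(a|s)` at time `t`. -/
def weight (π μ : Policy S A ν) (t : ℕ) (s : S) (a : A) : ℝ := π.dens t s a / μ.dens t s a

/-- The importance weights before the horizon are finite and uniformly bounded. -/
def BoundedWeights (π μ : Policy S A ν) (H : ℕ) : Prop :=
  (∀ t < H, ∀ s a, μ.dens t s a = 0 → π.dens t s a = 0) ∧
    BddAbove (Set.range fun x : Fin H × S × A => weight π μ x.1 x.2.1 x.2.2)

/-- `τ_a = max π(a|s) / μ(a|s)` over times, states and actions. -/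
def tauA (π μ : Policy S A ν) (H : ℕ) : ℝ :=
  ⨆ x : Fin H × S × A, weight π μ x.1 x.2.1 x.2.2

/-- `τ_s = max d_t^π(s) / d_t^μ(s)` over times and states. -/
def tauS (M : EpisodicMDP S A) (π μ : Policy S A ν) (H : ℕ) : ℝ :=
  ⨆ x : Fin H × S, stateDist M π x.1 x.2 / stateDist M μ x.1 x.2

/-- The pairs `(t, s)` such that `π` reaches the state `s` at time `t`. -/
abbrev Reached (M : EpisodicMDP S A) (π : Policy S A ν) (H : ℕ) : Type _ :=
  {x : Fin H × S // 0 < stateDist M π x.1 x.2}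

/-- `min d_t^μ(s)` over the pairs `(t, s)` reached by `π`. -/
def minDist (M : EpisodicMDP S A) (π μ : Policy S A ν) (H : ℕ) : ℝ :=
  ⨅ x : Reached M π H, stateDist M μ x.1.1 x.1.2

/-- `min max {d_t^π(s), d_t^μ(s)}` over the pairs `(t, s)` reached by `π`. -/
def minMaxDist (M : EpisodicMDP S A) (π μ : Policy S A ν) (H : ℕ) : ℝ :=
  ⨅ x : Reached M π H, max (stateDist M π x.1.1 x.1.2) (stateDist M μ x.1.1 x.1.2)

/-- The requirement on the number `n` of episodes. -/
def SampleSize (M : EpisodicMDP S A) (π μ : Policy S A ν) (H n : ℕ) : Prop :=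
  ∀ t : ℕ, 2 ≤ t → t ≤ H →
    max (4 * t * tauA π μ H * tauS M π μ H / minMaxDist M π μ H)
      (16 * Real.log n / minDist M π μ H) < n

end Rollout

section Estimator

variable {S A : Type*} [Fintype S] [MeasurableSpace A] {ν : Measure A} {H n : ℕ}

open Classical in
/-- The number of episodes in the data `D` that are in state `s` at time `t`. -/
def visits (D : Fin n → Traj S A H) (t : Fin (H + 1)) (s : S) : ℝ :=
  ∑ i, if (D i).1 t = s then 1 else 0

open Classical in
/-- The importance sampling estimate of the probability under `π` of moving from `s` to `s'` at
time `t`; it is `0` if `s` is not visited at time `t`. -/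
def transHat (π μ : Policy S A ν) (D : Fin n → Traj S A H) (t : Fin H) (s s' : S) : ℝ :=
  (1 / visits D t.castSucc s) *
    ∑ i, if (D i).1 t.castSucc = s ∧ (D i).1 t.succ = s' then weight π μ t s ((D i).2 t).1 else 0

open Classical in
/-- The importance sampling estimate of the expected reward under `π` in state `s` at time `t`; it
is `0` if `s` is not visited at time `t`. -/
def rewardHat (π μ : Policy S A ν) (D : Fin n → Traj S A H) (t : Fin H) (s : S) : ℝ :=
  (1 / visits D t.castSucc s) *
    ∑ i, if (D i).1 t.castSucc = s then weight π μ t s ((D i).2 t).1 * ((D i).2 t).2 else 0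

/-- The recursive estimate of the state distribution under `π`, starting from the empirical
distribution of the initial states. -/
def distHat (π μ : Policy S A ν) (D : Fin n → Traj S A H) : Fin (H + 1) → S → ℝ :=
  Fin.induction (motive := fun _ => S → ℝ) (fun s => visits D 0 s / n)
    (fun t d s' => ∑ s, transHat π μ D t s s' * d s)

/-- The marginalized importance sampling estimator of the value of `π`. -/
def misEstimator (π μ : Policy S A ν) (D : Fin n → Traj S A H) : ℝ :=
  ∑ t : Fin H, ∑ s, distHat π μ D t.castSucc s * rewardHat π μ D t s

/-- The estimator clipped to `[0, H * Rmax]`. -/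
def clippedEstimator (π μ : Policy S A ν) (Rmax : ℝ) (D : Fin n → Traj S A H) : ℝ :=
  max 0 (min (H * Rmax) (misEstimator π μ D))

end Estimator

section Error

variable {S A : Type*} [Fintype S] [MeasurableSpace S] [DiscreteMeasurableSpace S]
  [MeasurableSpace A] {ν : Measure A}

/-- The law of `n` independent episodes of horizon `H` collected with the behavior policy `μ`. -/
def dataLaw (M : EpisodicMDP S A) (μ : Policy S A ν) (H n : ℕ) :
    Measure (Fin n → Traj S A H) :=
  Measure.pi fun _ => rollout M μ H

/-- The squared error of the clipped estimator on the data `D`. -/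
def sqError (M : EpisodicMDP S A) (π μ : Policy S A ν) (H n : ℕ) (Rmax : ℝ)
    (D : Fin n → Traj S A H) : ℝ :=
  (clippedEstimator π μ Rmax D - value M π H) ^ 2

/-- The mean squared error of the clipped estimator. -/
def mse (M : EpisodicMDP S A) (π μ : Policy S A ν) (H n : ℕ) (Rmax : ℝ) : ℝ :=
  ∫ D, sqError M π μ H n Rmax D ∂(dataLaw M μ H n)

end Error

end MIS

end

set_option linter.unusedSectionVars false

noncomputable section

namespace MIS

/-! ### One step of the process -/

section Step

variable {S A : Type*} [Fintype S] [MeasurableSpace S] [DiscreteMeasurableSpace S]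
  [MeasurableSpace A] {ν : Measure A}

/-! The proof is a martingale decomposition with a self-consistent bound on the second moments of
`distHat`. Let `W` solve the Bellman equations of the target policy with terminal value `0`. The
quantity (estimated rewards before `t`) + `∑ s, d̂_t(s) W_t(s)` equals the estimator at `t = H`, and
at `t = 0` it is an empirical mean with expectation `v^π`. Its change at time `t` is a sum over
episodes of `d̂_t(s_i) / n_{t,s_i}` times the centered weighted one-step return. The importance
weight turns a step of `μ` into a step of `π` (`integral_weight_mul_step`), so given the data up to
time `t` these summands are centered, and they are independent across episodes. All cross terms
vanish (`integral_sq_add_increment`), and `integral_goodEst_sq_le` bounds the second moment of the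
error by an initial variance plus `∑ t, ∑ s, E[d̂_t(s)² / n_{t,s}] * returnSq`.

The decomposition needs every state with nonzero `d̂` to be visited, and the factor `1 / n_{t,s}`
must be controlled. Both come from the event `Good`, which is adapted: `goodDist` and the increments
are set to zero as soon as it fails, and the martingale structure survives. A Chernoff bound and the
logarithmic sample size condition give failure probability at most `H / n` (`real_not_good_le`);
there the clipped error is at most `H * Rmax`.

It remains to bound `E[d̂_t(s)² / n_{t,s}]`. The same decomposition with rewards switched off (`κ =
0`) and terminal function the indicator of `s` applies, with `W_u(s')` the probability under `π` of
being in `s` at time `t` when starting from `s'` at time `u`. If `E[d̂_u² / n_u] ≤ K d_u^π` for all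
`u < t`, it yields `E[d̂_t(s)²] ≤ p² + p / n + t τ_a K p` with `p = d_t^π(s)`
(`integral_goodDist_sq_le`). For `K = 4 τ_s / n` the first sample size condition absorbs the last
two terms into `p max(p, q)`, where `q = d_t^μ(s)`; division by `n q / 2` reproduces a bound at most
`K p`, which closes the induction (`meanSqDiv_le`). The induction keeps the sharper form in `p² / q`
and `p`, because under uniform coverage the factor `q` hidden in the importance weight cancels
against `1 / q`, leaving a single factor `|S| |A| / c` (`sum_meanSqDiv_mul_le_card`). Summation
against `d_t^π`, a probability vector, is what keeps the number of states out of the constants. -/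

instance (M : EpisodicMDP S A) (p : Policy S A ν) (t : ℕ) : IsMarkovKernel (step M p t) := by
  unfold step; infer_instance

theorem measurable_weight_action (π μ : Policy S A ν) (t : ℕ) (s : S) :
    Measurable (weight π μ t s) :=
  (π.measurable_dens t s).div (μ.measurable_dens t s)

theorem measurable_weight (π μ : Policy S A ν) (t : ℕ) :
    Measurable fun x : S × A => weight π μ t x.1 x.2 :=
  measurable_from_prod_countable_right fun s => measurable_weight_action π μ t s

theorem weight_nonneg (π μ : Policy S A ν) (t : ℕ) (s : S) (a : A) : 0 ≤ weight π μ t s a :=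
  div_nonneg (π.dens_nonneg t s a) (μ.dens_nonneg t s a)

theorem weight_le_tauA {π μ : Policy S A ν} {H : ℕ} (h : BoundedWeights π μ H) {t : ℕ}
    (ht : t < H) (s : S) (a : A) : weight π μ t s a ≤ tauA π μ H :=
  le_ciSup (f := fun x : Fin H × S × A => weight π μ x.1 x.2.1 x.2.2) h.2 (⟨t, ht⟩, s, a)

theorem dens_mul_weight {π μ : Policy S A ν} {t : ℕ} {s : S} {a : A}
    (h : μ.dens t s a = 0 → π.dens t s a = 0) :
    μ.dens t s a * weight π μ t s a = π.dens t s a := by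
  unfold weight
  by_cases h0 : μ.dens t s a = 0
  · simp [h0, h h0]
  · field_simp

/-- Integrate `π ≤ τ_a μ` over the actions; both densities have mass one. -/
theorem one_le_tauA [Nonempty S] {π μ : Policy S A ν} {H : ℕ} (h : BoundedWeights π μ H)
    (hH : 0 < H) : 1 ≤ tauA π μ H := by
  obtain ⟨s⟩ := ‹Nonempty S›
  have h1 : (1 : ENNReal) ≤ ENNReal.ofReal (tauA π μ H) := by
    calc (1 : ENNReal) = ∫⁻ a, ENNReal.ofReal (π.dens 0 s a) ∂ν := (π.lintegral_dens 0 s).symm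
      _ ≤ ∫⁻ a, ENNReal.ofReal (tauA π μ H) * ENNReal.ofReal (μ.dens 0 s a) ∂ν := by
        refine lintegral_mono fun a => ?_
        rw [← dens_mul_weight (h.1 0 hH s a), ENNReal.ofReal_mul (μ.dens_nonneg _ _ _), mul_comm]
        gcongr
        exact weight_le_tauA h hH s a
      _ = ENNReal.ofReal (tauA π μ H) := by
        rw [lintegral_const_mul _ (μ.measurable_dens 0 s).ennreal_ofReal, μ.lintegral_dens,
          mul_one]
  simpa using h1

theorem lintegral_step (M : EpisodicMDP S A) (p : Policy S A ν) (t : ℕ) (s : S)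
    {f : (A × S) × ℝ → ENNReal} (hf : Measurable f) :
    ∫⁻ x, f x ∂(step M p t s) =
      ∫⁻ a, ∫⁻ s', ∫⁻ r, f ((a, s'), r) ∂(M.reward t (s, a, s')) ∂(M.trans t (s, a))
        ∂(p.kernel t s) := by
  unfold step
  rw [Kernel.lintegral_compProd _ _ _ hf, Kernel.lintegral_compProd]
  exact hf.lintegral_kernel_prod_right'' (η := M.reward t) (a := s)

theorem kernel_withDensity {π μ : Policy S A ν} {t : ℕ} {s : S}
    (h : ∀ a, μ.dens t s a = 0 → π.dens t s a = 0) :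
    (μ.kernel t s).withDensity (fun a => ENNReal.ofReal (weight π μ t s a)) = π.kernel t s := by
  change (ν.withDensity _).withDensity _ = ν.withDensity _
  rw [← withDensity_mul _ (μ.measurable_dens t s).ennreal_ofReal
    (measurable_weight_action π μ t s).ennreal_ofReal]
  congr 1
  ext a
  rw [Pi.mul_apply, ← ENNReal.ofReal_mul (μ.dens_nonneg _ _ _), dens_mul_weight (h a)]

/-- The two policies share the transition and reward kernels, so the change of measure on actions
carries over to the whole step with a density that sees the action only. -/
theorem step_withDensity (M : EpisodicMDP S A) {π μ : Policy S A ν} {t : ℕ} {s : S}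
    (h : ∀ a, μ.dens t s a = 0 → π.dens t s a = 0) :
    (step M μ t s).withDensity (fun x => ENNReal.ofReal (weight π μ t s x.1.1)) =
      step M π t s := by
  have hw : Measurable fun a => ENNReal.ofReal (weight π μ t s a) :=
    (measurable_weight_action π μ t s).ennreal_ofReal
  have hw' : Measurable fun x : (A × S) × ℝ => ENNReal.ofReal (weight π μ t s x.1.1) :=
    hw.comp (measurable_fst.comp measurable_fst)
  refine Measure.ext_of_lintegral _ fun f hf => ?_
  rw [lintegral_withDensity_eq_lintegral_mul _ hw' hf, lintegral_step M μ t s (hw'.mul hf),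
    lintegral_step M π t s hf, ← kernel_withDensity h, lintegral_withDensity_eq_lintegral_mul _ hw]
  · refine lintegral_congr fun a => ?_
    simp only [Pi.mul_apply]
    rw [← lintegral_const_mul' _ _ ENNReal.ofReal_ne_top]
    refine lintegral_congr fun s' => ?_
    rw [← lintegral_const_mul' _ _ ENNReal.ofReal_ne_top]
  · have h1 : Measurable fun y : A × S =>
        ∫⁻ r, f (y, r) ∂(M.reward t (s, y)) :=
      hf.lintegral_kernel_prod_right'' (η := M.reward t) (a := s)
    exact h1.lintegral_kernel_prod_right'' (η := M.trans t) (a := s)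

theorem integral_weight_mul_step (M : EpisodicMDP S A) {π μ : Policy S A ν} {t : ℕ} {s : S}
    (h : ∀ a, μ.dens t s a = 0 → π.dens t s a = 0) (f : (A × S) × ℝ → ℝ) :
    ∫ x, weight π μ t s x.1.1 * f x ∂(step M μ t s) = ∫ x, f x ∂(step M π t s) := by
  rw [← step_withDensity M h, integral_withDensity_eq_integral_toReal_smul]
  · simp [ENNReal.toReal_ofReal (weight_nonneg _ _ _ _ _)]
  · exact ((measurable_weight_action π μ t s).comp
      (measurable_fst.comp measurable_fst)).ennreal_ofReal
  · simp

theorem measurable_weight_step (π μ : Policy S A ν) (t : ℕ) (s : S) :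
    Measurable fun x : (A × S) × ℝ => weight π μ t s x.1.1 :=
  (measurable_weight_action π μ t s).comp (measurable_fst.comp measurable_fst)

/-- The second moment of `r + w` is the variance plus the squared mean, and that mean lies in `[0,
B]`. -/
theorem BoundedRewards.lintegral_sq_le {M : EpisodicMDP S A} {H : ℕ} {Rmax σ : ℝ}
    (h : BoundedRewards M H Rmax σ) {t : ℕ} (ht : t < H) (s : S) (a : A) (s' : S) {w B : ℝ}
    (hw : 0 ≤ w) (hB : Rmax + w ≤ B) :
    ∫⁻ r, ENNReal.ofReal ((r + w) ^ 2) ∂(M.reward t (s, a, s')) ≤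
      ENNReal.ofReal (σ ^ 2 + B ^ 2) := by
  obtain ⟨h1, ⟨h2, h3⟩, h4⟩ := h t ht s a s'
  have hi : Integrable (fun r : ℝ => r) (M.reward t (s, a, s')) := h1.integrable (by norm_num)
  have hi2 : Integrable (fun r : ℝ => r ^ 2) (M.reward t (s, a, s')) := h1.integrable_sq
  have he : ∀ r : ℝ, (r + w) ^ 2 = r ^ 2 + (2 * w) * r + w ^ 2 := fun r => by ring
  simp_rw [he]
  have hi4 : Integrable (fun r : ℝ => r ^ 2 + (2 * w) * r) (M.reward t (s, a, s')) :=
    hi2.add (hi.const_mul (2 * w))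
  have hi3 : Integrable (fun r : ℝ => r ^ 2 + (2 * w) * r + w ^ 2) (M.reward t (s, a, s')) :=
    hi4.add (integrable_const (w ^ 2))
  rw [← ofReal_integral_eq_lintegral_ofReal hi3 (ae_of_all _ fun r => by
    simp only [Pi.zero_apply]; rw [← he]; positivity)]
  refine ENNReal.ofReal_le_ofReal ?_
  rw [integral_add hi4 (integrable_const _),
    integral_add hi2 (hi.const_mul (2 * w)), integral_const_mul]
  rw [variance_eq_sub h1] at h4
  simp only [id, Pi.pow_apply, integral_const, probReal_univ, one_smul] at h4 ⊢
  nlinarith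

theorem BoundedRewards.lintegral_step_sq_le {M : EpisodicMDP S A} {H : ℕ} {Rmax σ : ℝ}
    (h : BoundedRewards M H Rmax σ) (p : Policy S A ν) {t : ℕ} (ht : t < H) (s : S) {f : S → ℝ}
    {B : ℝ} (hf : ∀ s', 0 ≤ f s') (hB : ∀ s', Rmax + f s' ≤ B) {g : A → ENNReal}
    (hg : Measurable g) :
    ∫⁻ x, g x.1.1 * ENNReal.ofReal ((x.2 + f x.1.2) ^ 2) ∂(step M p t s) ≤
      (∫⁻ a, g a ∂(p.kernel t s)) * ENNReal.ofReal (σ ^ 2 + B ^ 2) := by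
  have hfm : Measurable f := Measurable.of_discrete
  rw [lintegral_step M p t s (by fun_prop), ← lintegral_mul_const _ hg]
  refine lintegral_mono fun a => ?_
  calc _ ≤ ∫⁻ s', g a * ENNReal.ofReal (σ ^ 2 + B ^ 2) ∂(M.trans t (s, a)) := by
        refine lintegral_mono fun s' => ?_
        dsimp only
        rw [lintegral_const_mul _ (by fun_prop)]
        gcongr
        exact h.lintegral_sq_le ht s a s' (hf s') (hB s')
    _ = _ := by simp

theorem BoundedRewards.Rmax_nonneg {M : EpisodicMDP S A} {H : ℕ} {Rmax σ : ℝ}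
    (h : BoundedRewards M H Rmax σ) {t : ℕ} (ht : t < H) (s : S) (a : A) : 0 ≤ Rmax :=
  ((h t ht s a s).2.1.1).trans (h t ht s a s).2.1.2

theorem Policy.nonempty_action (p : Policy S A ν) (s : S) : Nonempty A := by
  by_contra hne
  rw [not_nonempty_iff] at hne
  have := p.lintegral_dens 0 s
  rw [lintegral_of_isEmpty] at this
  exact zero_ne_one this

theorem EpisodicMDP.nonempty_state (M : EpisodicMDP S A) : Nonempty S :=
  nonempty_of_isProbabilityMeasure M.init

theorem BoundedRewards.memLp_step {M : EpisodicMDP S A} {H : ℕ} {Rmax σ : ℝ}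
    (h : BoundedRewards M H Rmax σ) (p : Policy S A ν) {t : ℕ} (ht : t < H) (s : S) :
    MemLp (fun x : (A × S) × ℝ => x.2) 2 (step M p t s) := by
  refine (memLp_two_iff_integrable_sq measurable_snd.aestronglyMeasurable).2 ⟨by fun_prop, ?_⟩
  have := h.lintegral_step_sq_le p ht s (f := fun _ => 0) (B := Rmax) (by simp) (by simp)
    (g := fun _ => 1) (by fun_prop)
  simp only [add_zero, one_mul, lintegral_one, measure_univ] at this
  rw [hasFiniteIntegral_iff_ofReal (ae_of_all _ fun x => by positivity)]
  exact this.trans_lt ENNReal.ofReal_lt_top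

theorem BoundedRewards.integral_step_mem {M : EpisodicMDP S A} {H : ℕ} {Rmax σ : ℝ}
    (h : BoundedRewards M H Rmax σ) (p : Policy S A ν) {t : ℕ} (ht : t < H) (s : S) :
    ∫ x, x.2 ∂(step M p t s) ∈ Set.Icc 0 Rmax := by
  obtain ⟨a₀⟩ := p.nonempty_action s
  have hi : Integrable (fun x : (A × S) × ℝ => x.2) (step M p t s) :=
    (h.memLp_step p ht s).integrable (by norm_num)
  have he : ∫ x, x.2 ∂(step M p t s) =
      ∫ y, ∫ r, r ∂(M.reward t (s, y)) ∂((p.kernel t ⊗ₖ M.trans t) s) := by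
    unfold step at hi ⊢
    rw [integral_compProd hi]
  rw [he]
  have hR := h.Rmax_nonneg ht s a₀
  constructor
  · exact integral_nonneg fun y => (h t ht s y.1 y.2).2.1.1
  · calc _ ≤ ∫ y, Rmax ∂((p.kernel t ⊗ₖ M.trans t) s) := by
          refine integral_mono_of_nonneg (ae_of_all _ fun y => (h t ht s y.1 y.2).2.1.1)
            (integrable_const _) (ae_of_all _ fun y => (h t ht s y.1 y.2).2.1.2)
      _ = Rmax := by simp

/-- The mean of the importance weight under the target policy. -/
def meanWeight (π μ : Policy S A ν) (t : ℕ) (s : S) : ℝ :=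
  ∫ a, weight π μ t s a ∂(π.kernel t s)

theorem integrable_weight {π μ : Policy S A ν} {H : ℕ} (h : BoundedWeights π μ H) {t : ℕ}
    (ht : t < H) (s : S) : Integrable (weight π μ t s) (π.kernel t s) :=
  Integrable.of_bound (measurable_weight_action π μ t s).aestronglyMeasurable (tauA π μ H)
    (ae_of_all _ fun a => by
      rw [Real.norm_of_nonneg (weight_nonneg _ _ _ _ _)]; exact weight_le_tauA h ht s a)

theorem meanWeight_nonneg (π μ : Policy S A ν) (t : ℕ) (s : S) : 0 ≤ meanWeight π μ t s :=
  integral_nonneg fun _ => weight_nonneg _ _ _ _ _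

theorem meanWeight_le_tauA {π μ : Policy S A ν} {H : ℕ} (h : BoundedWeights π μ H) {t : ℕ}
    (ht : t < H) (s : S) : meanWeight π μ t s ≤ tauA π μ H := by
  calc _ ≤ ∫ a, tauA π μ H ∂(π.kernel t s) :=
        integral_mono (integrable_weight h ht s) (integrable_const _) fun a =>
          weight_le_tauA h ht s a
    _ = _ := by simp

theorem meanWeight_eq_sum [Fintype A] [MeasurableSingletonClass A] {π μ : Policy S A ν}
    (hν : ν = Measure.count) (t : ℕ) (s : S) :
    meanWeight π μ t s = ∑ a, π.dens t s a * weight π μ t s a := by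
  subst hν
  unfold meanWeight
  change ∫ a, _ ∂(Measure.count.withDensity _) = _
  rw [integral_withDensity_eq_integral_toReal_smul (π.measurable_dens t s).ennreal_ofReal
    (by simp), integral_count]
  simp [ENNReal.toReal_ofReal (π.dens_nonneg _ _ _)]

/-- The second moment of the weighted one-step return under the behavior policy. -/
def returnSq (M : EpisodicMDP S A) (π μ : Policy S A ν) (κ : ℝ) (f : S → ℝ) (t : ℕ) (s : S) : ℝ :=
  ∫ x, (weight π μ t s x.1.1 * (κ * x.2 + f x.1.2)) ^ 2 ∂(step M μ t s)

/-- One of the two factors of the squared weight is spent on passing from `μ` to `π`. The variance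
is therefore linear, not quadratic, in the weight. -/
theorem returnSq_eq (M : EpisodicMDP S A) {π μ : Policy S A ν} (κ : ℝ) (f : S → ℝ) {t : ℕ} {s : S}
    (h : ∀ a, μ.dens t s a = 0 → π.dens t s a = 0) :
    returnSq M π μ κ f t s =
      ∫ x, weight π μ t s x.1.1 * (κ * x.2 + f x.1.2) ^ 2 ∂(step M π t s) := by
  unfold returnSq
  rw [← integral_weight_mul_step M h]
  congr 1
  ext x
  ring

theorem returnSq_nonneg (M : EpisodicMDP S A) (π μ : Policy S A ν) (κ : ℝ) (f : S → ℝ) (t : ℕ)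
    (s : S) : 0 ≤ returnSq M π μ κ f t s :=
  integral_nonneg fun _ => sq_nonneg _

theorem returnSq_one_le {M : EpisodicMDP S A} {π μ : Policy S A ν} {H : ℕ} {Rmax σ : ℝ}
    (hr : BoundedRewards M H Rmax σ) (hw : BoundedWeights π μ H) {t : ℕ} (ht : t < H) (s : S)
    {f : S → ℝ} {B : ℝ} (hf : ∀ s', 0 ≤ f s') (hB : ∀ s', Rmax + f s' ≤ B) :
    returnSq M π μ 1 f t s ≤ meanWeight π μ t s * (σ ^ 2 + B ^ 2) := by
  have hfm : Measurable f := Measurable.of_discrete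
  have hwm := measurable_weight_step π μ t s
  rw [returnSq_eq M 1 f (hw.1 t ht s), integral_eq_lintegral_of_nonneg_ae
    (ae_of_all _ fun x => mul_nonneg (weight_nonneg _ _ _ _ _) (sq_nonneg _))
    (by fun_prop : Measurable _).aestronglyMeasurable]
  have h1 := hr.lintegral_step_sq_le π ht s hf hB
    (measurable_weight_action π μ t s).ennreal_ofReal
  rw [← ofReal_integral_eq_lintegral_ofReal (integrable_weight hw ht s)
    (ae_of_all _ fun a => weight_nonneg _ _ _ _ _), ← meanWeight,
    ← ENNReal.ofReal_mul (meanWeight_nonneg π μ t s)] at h1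
  refine ENNReal.toReal_le_of_le_ofReal
    (mul_nonneg (meanWeight_nonneg π μ t s) (by positivity)) (le_trans (le_of_eq ?_) h1)
  refine lintegral_congr fun x => ?_
  rw [one_mul, ENNReal.ofReal_mul (weight_nonneg _ _ _ _ _)]

/-- Since `f² ≤ f` on `[0, 1]`, the bound is linear in `f`. For the reaching probabilities used
later, the right side becomes `τ_a` times the same probability one step earlier. -/
theorem returnSq_zero_le {M : EpisodicMDP S A} {π μ : Policy S A ν} {H : ℕ}
    (hw : BoundedWeights π μ H) {t : ℕ} (ht : t < H) (s : S)
    {f : S → ℝ} (hf : ∀ s', f s' ∈ Set.Icc 0 1) :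
    returnSq M π μ 0 f t s ≤ tauA π μ H * ∫ x, f x.1.2 ∂(step M π t s) := by
  have hfm : Measurable f := Measurable.of_discrete
  have hi : Integrable (fun x : (A × S) × ℝ => f x.1.2) (step M π t s) :=
    Integrable.of_bound (by fun_prop : Measurable _).aestronglyMeasurable 1
      (ae_of_all _ fun x => by rw [Real.norm_of_nonneg (hf _).1]; exact (hf _).2)
  rw [returnSq_eq M 0 f (hw.1 t ht s), ← integral_const_mul]
  refine integral_mono_of_nonneg
    (ae_of_all _ fun x => mul_nonneg (weight_nonneg _ _ _ _ _) (sq_nonneg _))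
    (hi.const_mul _) (ae_of_all _ fun x => ?_)
  simp only [zero_mul, zero_add]
  have h1 := weight_le_tauA hw ht s x.1.1
  have h0 := weight_nonneg π μ t s x.1.1
  have h2 := hf x.1.2
  have h3 : f x.1.2 ^ 2 ≤ f x.1.2 := by nlinarith [h2.1, h2.2]
  exact mul_le_mul h1 h3 (sq_nonneg _) (h0.trans h1)

end Step

/-! ### The law of a single episode -/

section Rollout

variable {S A : Type*} [Fintype S] [MeasurableSpace S] [DiscreteMeasurableSpace S]
  [MeasurableSpace A] {ν : Measure A}

theorem measurable_appendStep {h : ℕ} :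
    Measurable (appendStep : Traj S A h × ((A × S) × ℝ) → Traj S A (h + 1)) := by
  refine Measurable.prodMk ?_ ?_
  · refine measurable_pi_lambda _ fun u => ?_
    induction u using Fin.lastCases with
    | last => simp only [Fin.snoc_last]; fun_prop
    | cast u => simp only [Fin.snoc_castSucc]; fun_prop
  · refine measurable_pi_lambda _ fun u => ?_
    induction u using Fin.lastCases with
    | last => simp only [Fin.snoc_last]; fun_prop
    | cast u => simp only [Fin.snoc_castSucc]; fun_prop

theorem measurable_initial :
    Measurable fun s : S => ((fun _ => s, Fin.elim0) : Traj S A 0) := by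
  fun_prop

instance isProbabilityMeasure_rollout (M : EpisodicMDP S A) (p : Policy S A ν) :
    (h : ℕ) → IsProbabilityMeasure (rollout M p h)
  | 0 => Measure.isProbabilityMeasure_map measurable_initial.aemeasurable
  | h + 1 => by
    have := isProbabilityMeasure_rollout M p h
    exact Measure.isProbabilityMeasure_map measurable_appendStep.aemeasurable

/-- The kernel that continues an episode of length `h` by one step. -/
abbrev nextStep (M : EpisodicMDP S A) (p : Policy S A ν) (h : ℕ) :
    Kernel (Traj S A h) ((A × S) × ℝ) :=
  (step M p h).comap (fun τ : Traj S A h => τ.1 (Fin.last h)) (by fun_prop)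

/-- The first `h` steps of an episode. -/
def truncate {h H : ℕ} (hh : h ≤ H) (τ : Traj S A H) : Traj S A h :=
  (fun u => τ.1 (Fin.castLE (by omega) u), fun u => τ.2 (Fin.castLE hh u))

/-- The action, next state and reward at time `t`. -/
def stepAt {H : ℕ} (t : Fin H) (τ : Traj S A H) : (A × S) × ℝ :=
  (((τ.2 t).1, τ.1 t.succ), (τ.2 t).2)

theorem measurable_truncate {h H : ℕ} (hh : h ≤ H) :
    Measurable (truncate hh : Traj S A H → Traj S A h) := by
  unfold truncate; fun_prop

theorem measurable_stepAt {H : ℕ} (t : Fin H) :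
    Measurable (stepAt t : Traj S A H → (A × S) × ℝ) := by
  unfold stepAt; fun_prop

theorem truncate_appendStep {h H : ℕ} (hh : h ≤ H) (x : Traj S A H × ((A × S) × ℝ)) :
    truncate (hh.trans H.le_succ) (appendStep x) = truncate hh x.1 := by
  unfold truncate appendStep
  ext u
  · exact Fin.snoc_castSucc (α := fun _ => S) _ _ (Fin.castLE (by omega : h + 1 ≤ H + 1) u)
  all_goals
    congr 1
    exact Fin.snoc_castSucc (α := fun _ => A × ℝ) _ _ (Fin.castLE hh u)

theorem truncate_self {H : ℕ} : (truncate le_rfl : Traj S A H → Traj S A H) = id := rfl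

theorem map_truncate (M : EpisodicMDP S A) (p : Policy S A ν) {h H : ℕ} (hh : h ≤ H) :
    (rollout M p H).map (truncate hh) = rollout M p h := by
  induction H, hh using Nat.le_induction with
  | base => rw [truncate_self, Measure.map_id]
  | succ H hh ih =>
    rw [rollout, Measure.map_map (measurable_truncate _) measurable_appendStep]
    have : truncate (hh.trans H.le_succ) ∘ appendStep =
        truncate hh ∘ (Prod.fst : Traj S A H × ((A × S) × ℝ) → _) :=
      funext fun x => truncate_appendStep hh x
    rw [this, ← Measure.map_map (measurable_truncate _) measurable_fst, ← Measure.fst,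
      Measure.fst_compProd, ih]

/-- The Markov property in the form used throughout: the past up to `t` and the step at `t` have a
composition-product law, whatever the horizon. -/
theorem map_truncate_stepAt (M : EpisodicMDP S A) (p : Policy S A ν) {H : ℕ} (t : Fin H) :
    (rollout M p H).map (fun τ => (truncate t.isLt.le τ, stepAt t τ)) =
      rollout M p t ⊗ₘ nextStep M p t := by
  have h1 : (fun τ : Traj S A H => (truncate t.isLt.le τ, stepAt t τ)) =
      (fun τ : Traj S A (t + 1) => (truncate (Nat.le_succ t) τ, stepAt (Fin.last t) τ)) ∘
        truncate (Nat.succ_le_of_lt t.isLt) := rfl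
  have h2 : Measurable fun τ : Traj S A (t + 1) =>
      (truncate (Nat.le_succ t) τ, stepAt (Fin.last t) τ) :=
    (measurable_truncate _).prodMk (measurable_stepAt _)
  rw [h1, ← Measure.map_map h2 (measurable_truncate _), map_truncate, rollout,
    Measure.map_map h2 measurable_appendStep]
  have h3 : (fun τ : Traj S A (t + 1) => (truncate (Nat.le_succ t) τ, stepAt (Fin.last t) τ)) ∘
      appendStep = id := by
    funext x
    refine Prod.ext (truncate_appendStep le_rfl x) (Prod.ext (Prod.ext ?_ ?_) ?_)
    · exact congrArg (fun y : A × ℝ => y.1)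
        (Fin.snoc_last (α := fun _ => A × ℝ) (x.2.1.1, x.2.2) x.1.2)
    · exact Fin.snoc_last (α := fun _ => S) x.2.1.2 x.1.1
    · exact congrArg (fun y : A × ℝ => y.2)
        (Fin.snoc_last (α := fun _ => A × ℝ) (x.2.1.1, x.2.2) x.1.2)
  rw [h3, Measure.map_id]

theorem measurePreserving_truncate_stepAt (M : EpisodicMDP S A) (p : Policy S A ν) {H : ℕ}
    (t : Fin H) :
    MeasurePreserving (fun τ => (truncate t.isLt.le τ, stepAt t τ)) (rollout M p H)
      (rollout M p t ⊗ₘ nextStep M p t) :=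
  ⟨(measurable_truncate _).prodMk (measurable_stepAt _), map_truncate_stepAt M p t⟩

/-- Two episodes have the same states up to time `t` and the same actions and rewards before. -/
def AgreeUpTo (t : ℕ) {H : ℕ} (τ τ' : Traj S A H) : Prop :=
  (∀ u : Fin (H + 1), (u : ℕ) ≤ t → τ.1 u = τ'.1 u) ∧ ∀ u : Fin H, (u : ℕ) < t → τ.2 u = τ'.2 u

theorem AgreeUpTo.refl (t : ℕ) {H : ℕ} (τ : Traj S A H) : AgreeUpTo t τ τ :=
  ⟨fun _ _ => rfl, fun _ _ => rfl⟩

theorem AgreeUpTo.mono {t t' : ℕ} (h : t' ≤ t) {H : ℕ} {τ τ' : Traj S A H}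
    (ha : AgreeUpTo t τ τ') : AgreeUpTo t' τ τ' :=
  ⟨fun u hu => ha.1 u (hu.trans h), fun u hu => ha.2 u (hu.trans_le h)⟩

theorem exists_eq_comp_truncate [Nonempty A] {H t : ℕ} (ht : t ≤ H) {g : Traj S A H → ℝ}
    (hg : Measurable g) (hd : ∀ τ τ', AgreeUpTo t τ τ' → g τ = g τ') :
    ∃ g' : Traj S A t → ℝ, Measurable g' ∧ ∀ τ, g τ = g' (truncate ht τ) := by
  obtain ⟨a₀⟩ := ‹Nonempty A›
  -- Any measurable extension of a truncated episode works. Here the state freezes at time `t` and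
  -- later actions and rewards are constant.
  let e : Traj S A t → Traj S A H := fun τ =>
    (fun u => τ.1 ⟨min u t, by omega⟩, fun u => if h : (u : ℕ) < t then τ.2 ⟨u, h⟩ else (a₀, 0))
  have he : Measurable e := by
    refine Measurable.prodMk (by fun_prop) (measurable_pi_lambda _ fun u => ?_)
    split_ifs
    · fun_prop
    · fun_prop
  refine ⟨g ∘ e, hg.comp he, fun τ => hd _ _ ⟨fun u hu => ?_, fun u hu => ?_⟩⟩
  · simp only [e, truncate]
    exact congrArg τ.1 (Fin.ext (by simp [hu]))
  · simp [e, truncate, hu]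

/-- Orthogonality of a conditionally centered step to the past. No integrability is needed, because
the integral of a non-integrable function is `0` by convention. -/
theorem integral_mul_stepAt_eq_zero (M : EpisodicMDP S A) (p : Policy S A ν) {H : ℕ} (t : Fin H)
    {g : Traj S A H → ℝ} (hg : Measurable g) (hd : ∀ τ τ', AgreeUpTo t τ τ' → g τ = g τ')
    {φ : S → (A × S) × ℝ → ℝ} (hφ : ∀ s, Measurable (φ s))
    (h0 : ∀ s, ∫ x, φ s x ∂(step M p t s) = 0) :
    ∫ τ, g τ * φ (τ.1 t.castSucc) (stepAt t τ) ∂(rollout M p H) = 0 := by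
  obtain ⟨s₀⟩ := M.nonempty_state
  have := p.nonempty_action s₀
  obtain ⟨g', hg', he⟩ := exists_eq_comp_truncate t.isLt.le hg hd
  have hφ' : Measurable fun x : S × ((A × S) × ℝ) => φ x.1 x.2 :=
    measurable_from_prod_countable_right hφ
  let F : Traj S A t × ((A × S) × ℝ) → ℝ := fun y => g' y.1 * φ (y.1.1 (Fin.last t)) y.2
  have hF : Measurable F := (hg'.comp measurable_fst).mul (hφ'.comp (by fun_prop :
    Measurable fun y : Traj S A t × ((A × S) × ℝ) => (y.1.1 (Fin.last t), y.2)))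
  have h1 : ∀ τ, g τ * φ (τ.1 t.castSucc) (stepAt t τ) = F (truncate t.isLt.le τ, stepAt t τ) :=
    fun τ => by rw [he]; rfl
  have h2 := (measurePreserving_truncate_stepAt M p t)
  simp_rw [h1]
  rw [← integral_map h2.measurable.aemeasurable (f := F) hF.aestronglyMeasurable, h2.map_eq]
  by_cases hi : Integrable F (rollout M p t ⊗ₘ nextStep M p t)
  · rw [Measure.integral_compProd hi]
    simp only [F, Kernel.comap_apply, integral_const_mul, h0, mul_zero, integral_zero]
  · exact integral_undef hi

/-- The probability of moving from `s` to `s'` at time `t`. -/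
def transProb (M : EpisodicMDP S A) (p : Policy S A ν) (t : ℕ) (s s' : S) : ℝ :=
  (step M p t s).real {x | x.1.2 = s'}

theorem integral_stateDist (M : EpisodicMDP S A) (p : Policy S A ν) (t : ℕ) (f : S → ℝ) :
    ∫ τ, f (τ.1 (Fin.last t)) ∂(rollout M p t) = ∑ s, stateDist M p t s * f s := by
  have hm : Measurable fun τ : Traj S A t => τ.1 (Fin.last t) := by fun_prop
  rw [← integral_map hm.aemeasurable (f := f) Measurable.of_discrete.aestronglyMeasurable]
  have := Measure.isProbabilityMeasure_map (μ := rollout M p t) hm.aemeasurable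
  rw [integral_fintype .of_finite]
  refine Finset.sum_congr rfl fun s _ => ?_
  rw [smul_eq_mul, stateDist, measureReal_def, measureReal_def, Measure.map_apply hm (by simp)]
  rfl

theorem integral_transProb (M : EpisodicMDP S A) (p : Policy S A ν) (t : ℕ) (s : S) (f : S → ℝ) :
    ∫ x, f x.1.2 ∂(step M p t s) = ∑ s', transProb M p t s s' * f s' := by
  have hm : Measurable fun x : (A × S) × ℝ => x.1.2 := by fun_prop
  rw [← integral_map hm.aemeasurable (f := f) Measurable.of_discrete.aestronglyMeasurable]
  have := Measure.isProbabilityMeasure_map (μ := step M p t s) hm.aemeasurable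
  rw [integral_fintype .of_finite]
  refine Finset.sum_congr rfl fun s _ => ?_
  rw [smul_eq_mul, transProb, measureReal_def, measureReal_def, Measure.map_apply hm (by simp)]
  rfl

theorem integral_state (M : EpisodicMDP S A) (p : Policy S A ν) {H : ℕ} (t : Fin (H + 1))
    (f : S → ℝ) :
    ∫ τ, f (τ.1 t) ∂(rollout M p H) = ∑ s, stateDist M p t s * f s := by
  have ht : (t : ℕ) ≤ H := Nat.lt_succ_iff.1 t.isLt
  have hm : Measurable fun τ : Traj S A t => f (τ.1 (Fin.last t)) :=
    (Measurable.of_discrete (f := f)).comp (by fun_prop)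
  rw [← integral_stateDist, ← map_truncate M p ht,
    integral_map (measurable_truncate ht).aemeasurable hm.aestronglyMeasurable]
  rfl

theorem stateDist_nonneg (M : EpisodicMDP S A) (p : Policy S A ν) (t : ℕ) (s : S) :
    0 ≤ stateDist M p t s := measureReal_nonneg

theorem stateDist_le_one (M : EpisodicMDP S A) (p : Policy S A ν) (t : ℕ) (s : S) :
    stateDist M p t s ≤ 1 := measureReal_le_one

theorem sum_stateDist (M : EpisodicMDP S A) (p : Policy S A ν) (t : ℕ) :
    ∑ s, stateDist M p t s = 1 := by
  simpa using (integral_stateDist M p t fun _ => 1).symm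

theorem transProb_nonneg (M : EpisodicMDP S A) (p : Policy S A ν) (t : ℕ) (s s' : S) :
    0 ≤ transProb M p t s s' := measureReal_nonneg

theorem sum_transProb (M : EpisodicMDP S A) (p : Policy S A ν) (t : ℕ) (s : S) :
    ∑ s', transProb M p t s s' = 1 := by
  simpa using (integral_transProb M p t s fun _ => 1).symm

theorem integral_stepAt (M : EpisodicMDP S A) (p : Policy S A ν) {H : ℕ} (t : Fin H)
    {φ : (A × S) × ℝ → ℝ} (hφ : Measurable φ)
    (hi : Integrable (fun τ => φ (stepAt t τ)) (rollout M p H)) :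
    ∫ τ, φ (stepAt t τ) ∂(rollout M p H) =
      ∑ s, stateDist M p t s * ∫ x, φ x ∂(step M p t s) := by
  have h2 := measurePreserving_truncate_stepAt M p t
  have hm : Measurable fun y : Traj S A t × ((A × S) × ℝ) => φ y.2 := by fun_prop
  have hi' : Integrable (fun y : Traj S A t × ((A × S) × ℝ) => φ y.2)
      (rollout M p t ⊗ₘ nextStep M p t) :=
    (h2.integrable_comp hm.aestronglyMeasurable).1 hi
  have h3 := integral_map (μ := rollout M p H) h2.measurable.aemeasurable (f := fun y => φ y.2)
    hm.aestronglyMeasurable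
  rw [h2.map_eq, Measure.integral_compProd hi'] at h3
  rw [← integral_stateDist]
  exact h3.symm

theorem stateDist_succ (M : EpisodicMDP S A) (p : Policy S A ν) (t : ℕ) (s' : S) :
    stateDist M p (t + 1) s' = ∑ s, stateDist M p t s * transProb M p t s s' := by
  classical
  let f : S → ℝ := fun s => if s = s' then 1 else 0
  have hf : Measurable f := Measurable.of_discrete
  have h := integral_stepAt M p (Fin.last t) (φ := fun x => f x.1.2) (by fun_prop)
    (Integrable.of_bound (hf.comp ((measurable_snd.comp measurable_fst).comp
      (measurable_stepAt _))).aestronglyMeasurable 1 (ae_of_all _ fun τ => by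
        simp only [f]; split_ifs <;> simp))
  simp only [integral_transProb] at h
  have h2 := integral_stateDist M p (t + 1) f
  have h3 := h2.symm.trans h
  simpa [f] using h3

theorem BoundedRewards.memLp_rollout {M : EpisodicMDP S A} {H : ℕ} {Rmax σ : ℝ}
    (h : BoundedRewards M H Rmax σ) (p : Policy S A ν) (t : Fin H) :
    MemLp (fun τ : Traj S A H => (τ.2 t).2) 2 (rollout M p H) := by
  have h2 := measurePreserving_truncate_stepAt M p t
  have h1 : MemLp (fun y : Traj S A t × ((A × S) × ℝ) => y.2.2) 2
      (rollout M p t ⊗ₘ nextStep M p t) := by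
    refine (memLp_two_iff_integrable_sq (by fun_prop : Measurable _).aestronglyMeasurable).2
      ⟨(by fun_prop : Measurable _).aestronglyMeasurable, ?_⟩
    rw [hasFiniteIntegral_iff_ofReal (ae_of_all _ fun x => by positivity),
      Measure.lintegral_compProd (by fun_prop)]
    refine lt_of_le_of_lt (lintegral_mono fun τ => ?_)
      (b := ∫⁻ _, ENNReal.ofReal (σ ^ 2 + Rmax ^ 2) ∂(rollout M p t)) (by simp)
    have := h.lintegral_step_sq_le p t.isLt (τ.1 (Fin.last t)) (f := fun _ => 0) (B := Rmax)
      (by simp) (by simp) (g := fun _ => 1) (by fun_prop)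
    simpa using this
  exact h1.comp_measurePreserving h2

theorem value_eq_sum {M : EpisodicMDP S A} {H : ℕ} {Rmax σ : ℝ}
    (h : BoundedRewards M H Rmax σ) (p : Policy S A ν) :
    value M p H = ∑ t : Fin H, ∑ s, stateDist M p t s * ∫ x, x.2 ∂(step M p t s) := by
  unfold value
  have hi : ∀ t : Fin H, Integrable (fun τ : Traj S A H => (τ.2 t).2) (rollout M p H) :=
    fun t => (h.memLp_rollout p t).integrable (by norm_num)
  rw [integral_finsetSum _ fun t _ => hi t]
  exact Finset.sum_congr rfl fun t _ => integral_stepAt M p t (φ := Prod.snd) measurable_snd (hi t)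

theorem value_mem_Icc {M : EpisodicMDP S A} {H : ℕ} {Rmax σ : ℝ}
    (h : BoundedRewards M H Rmax σ) (p : Policy S A ν) :
    value M p H ∈ Set.Icc 0 (H * Rmax) := by
  rw [value_eq_sum h p]
  constructor
  · exact Finset.sum_nonneg fun t _ => Finset.sum_nonneg fun s _ =>
      mul_nonneg (stateDist_nonneg _ _ _ _) (h.integral_step_mem p t.isLt s).1
  · calc _ ≤ ∑ t : Fin H, ∑ s, stateDist M p t s * Rmax := by
          gcongr with t _ s _
          · exact stateDist_nonneg _ _ _ _
          · exact (h.integral_step_mem p t.isLt s).2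
      _ = H * Rmax := by simp [← Finset.sum_mul, sum_stateDist]

/-! ### Comparison of the target and the behavior policy -/

theorem transProb_eq (M : EpisodicMDP S A) {π μ : Policy S A ν} {H : ℕ}
    (hw : BoundedWeights π μ H) {t : ℕ} (ht : t < H) (s s' : S) :
    transProb M π t s s' =
      ∫ x, weight π μ t s x.1.1 * ({x | x.1.2 = s'} : Set ((A × S) × ℝ)).indicator 1 x
        ∂(step M μ t s) := by
  have hm : MeasurableSet ({x | x.1.2 = s'} : Set ((A × S) × ℝ)) :=
    (measurable_snd.comp measurable_fst) (measurableSet_singleton s')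
  rw [integral_weight_mul_step M (hw.1 t ht s), integral_indicator_one hm, transProb]

theorem transProb_le (M : EpisodicMDP S A) {π μ : Policy S A ν} {H : ℕ}
    (hw : BoundedWeights π μ H) {t : ℕ} (ht : t < H) (s s' : S) :
    transProb M π t s s' ≤ tauA π μ H * transProb M μ t s s' := by
  have hm : MeasurableSet ({x | x.1.2 = s'} : Set ((A × S) × ℝ)) :=
    (measurable_snd.comp measurable_fst) (measurableSet_singleton s')
  rw [transProb_eq M hw ht, transProb, ← integral_indicator_one hm, ← integral_const_mul]
  refine integral_mono_of_nonneg (ae_of_all _ fun x => mul_nonneg (weight_nonneg _ _ _ _ _) ?_)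
    (((integrable_const 1).indicator hm).const_mul _) (ae_of_all _ fun x => ?_)
  · exact Set.indicator_nonneg (fun _ _ => zero_le_one) _
  · exact mul_le_mul_of_nonneg_right (weight_le_tauA hw ht s x.1.1)
      (Set.indicator_nonneg (fun _ _ => zero_le_one) _)

theorem stateDist_zero_eq (M : EpisodicMDP S A) (π μ : Policy S A ν) (s : S) :
    stateDist M π 0 s = stateDist M μ 0 s := rfl

/-- Absolute continuity propagates in time: the initial laws coincide, and transition probabilities
under `π` are at most `τ_a` times those under `μ`. -/
theorem stateDist_eq_zero {M : EpisodicMDP S A} {π μ : Policy S A ν} {H : ℕ}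
    (hw : BoundedWeights π μ H) {t : ℕ} (ht : t ≤ H) {s : S} (h0 : stateDist M μ t s = 0) :
    stateDist M π t s = 0 := by
  induction t generalizing s with
  | zero => exact h0
  | succ t ih =>
    rw [stateDist_succ] at h0 ⊢
    rw [Finset.sum_eq_zero_iff_of_nonneg fun s _ =>
      mul_nonneg (stateDist_nonneg _ _ _ _) (transProb_nonneg _ _ _ _ _)] at h0
    refine Finset.sum_eq_zero fun s' hs' => ?_
    rcases mul_eq_zero.1 (h0 s' hs') with h | h
    · rw [ih (Nat.le_of_succ_le ht) h, zero_mul]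
    · have := transProb_le M hw ht s' s
      rw [h, mul_zero] at this
      rw [le_antisymm this (transProb_nonneg _ _ _ _ _), mul_zero]

theorem stateDist_pos {M : EpisodicMDP S A} {π μ : Policy S A ν} {H : ℕ}
    (hw : BoundedWeights π μ H) {t : ℕ} (ht : t ≤ H) {s : S} (h0 : 0 < stateDist M π t s) :
    0 < stateDist M μ t s :=
  (stateDist_nonneg M μ t s).lt_of_ne' fun h => h0.ne' (stateDist_eq_zero hw ht h)

theorem div_le_tauS (M : EpisodicMDP S A) (π μ : Policy S A ν) {H : ℕ} {t : ℕ}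
    (ht : t < H) (s : S) : stateDist M π t s / stateDist M μ t s ≤ tauS M π μ H :=
  le_ciSup (f := fun x : Fin H × S => stateDist M π x.1 x.2 / stateDist M μ x.1 x.2)
    (Set.finite_range _).bddAbove (⟨t, ht⟩, s)

theorem stateDist_le_tauS_mul {M : EpisodicMDP S A} {π μ : Policy S A ν} {H : ℕ}
    (hw : BoundedWeights π μ H) {t : ℕ} (ht : t < H) (s : S) :
    stateDist M π t s ≤ tauS M π μ H * stateDist M μ t s := by
  rcases (stateDist_nonneg M μ t s).eq_or_lt with h | h
  · rw [stateDist_eq_zero hw ht.le h.symm, ← h, mul_zero]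
  · exact (div_le_iff₀ h).1 (div_le_tauS M π μ ht s)

theorem one_le_tauS {M : EpisodicMDP S A} {π μ : Policy S A ν} {H : ℕ}
    (hw : BoundedWeights π μ H) (hH : 0 < H) : 1 ≤ tauS M π μ H := by
  calc 1 = ∑ s, stateDist M π 0 s := (sum_stateDist M π 0).symm
    _ ≤ ∑ s, tauS M π μ H * stateDist M μ 0 s :=
      Finset.sum_le_sum fun s _ => stateDist_le_tauS_mul hw hH s
    _ = tauS M π μ H := by rw [← Finset.mul_sum, sum_stateDist, mul_one]

end Rollout

/-! ### Independent episodes -/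

section Product

variable {X : Type*} [MeasurableSpace X]

/-- Resampling one coordinate of an i.i.d. sample leaves its law unchanged. This isolates a single
episode without splitting the product. -/
theorem measurePreserving_update (P : Measure X) [IsProbabilityMeasure P] {n : ℕ} (i : Fin n) :
    MeasurePreserving (fun y : (Fin n → X) × X => Function.update y.1 i y.2)
      ((Measure.pi fun _ => P).prod P) (Measure.pi fun _ => P) := by
  have hm : Measurable fun y : (Fin n → X) × X => Function.update y.1 i y.2 := by
    refine measurable_pi_lambda _ fun j => ?_
    by_cases h : j = i
    · subst h; simpa using measurable_snd
    · simp only [Function.update_of_ne h]; fun_prop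
  refine ⟨hm, (Measure.pi_eq fun s hs => ?_).symm⟩
  rw [Measure.map_apply hm (MeasurableSet.univ_pi hs)]
  have h1 : (fun y : (Fin n → X) × X => Function.update y.1 i y.2) ⁻¹' Set.univ.pi s =
      (Set.univ.pi (Function.update s i Set.univ)) ×ˢ s i := by
    ext y
    simp only [Set.mem_preimage, Set.mem_univ_pi, Set.mem_prod]
    constructor
    · intro h
      refine ⟨fun j => ?_, by simpa using h i⟩
      by_cases hj : j = i
      · subst hj; simp
      · simpa [hj] using h j
    · rintro ⟨h, h'⟩ j
      by_cases hj : j = i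
      · subst hj; simpa using h'
      · simpa [hj] using h j
  rw [h1, Measure.prod_prod, Measure.pi_pi, ← Finset.mul_prod_erase _ _ (Finset.mem_univ i),
    ← Finset.mul_prod_erase _ (fun j => P (s j)) (Finset.mem_univ i)]
  simp only [Function.update_self, measure_univ, one_mul]
  rw [mul_comm]
  congr 1
  refine Finset.prod_congr rfl fun j hj => ?_
  rw [Function.update_of_ne (Finset.ne_of_mem_erase hj)]

theorem integral_eq_zero_of_update (P : Measure X) [IsProbabilityMeasure P] {n : ℕ} (i : Fin n)
    {f : (Fin n → X) → ℝ} (hf : Measurable f)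
    (h0 : ∀ D, ∫ x, f (Function.update D i x) ∂P = 0) : ∫ D, f D ∂(Measure.pi fun _ => P) = 0 := by
  by_cases hi : Integrable f (Measure.pi fun _ => P)
  · have h := measurePreserving_update P i
    have h1 := integral_map (μ := (Measure.pi fun _ : Fin n => P).prod P) h.measurable.aemeasurable
      (f := f) hf.aestronglyMeasurable
    have h2 : Integrable (fun y : (Fin n → X) × X => f (Function.update y.1 i y.2))
        ((Measure.pi fun _ => P).prod P) := (h.integrable_comp hf.aestronglyMeasurable).2 hi
    rw [h.map_eq, integral_prod _ h2] at h1
    simpa [h0] using h1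
  · exact integral_undef hi

theorem integral_sq_add_sum {P : Measure X} {ι : Type*} [Fintype ι] {Z : X → ℝ}
    {Y : ι → X → ℝ} (hZ : MemLp Z 2 P) (hY : ∀ i, MemLp (Y i) 2 P)
    (hZY : ∀ i, ∫ x, Z x * Y i x ∂P = 0) (hYY : ∀ i j, i ≠ j → ∫ x, Y i x * Y j x ∂P = 0) :
    ∫ x, (Z x + ∑ i, Y i x) ^ 2 ∂P = ∫ x, Z x ^ 2 ∂P + ∑ i, ∫ x, Y i x ^ 2 ∂P := by
  have he : ∀ x, (Z x + ∑ i, Y i x) ^ 2 =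
      (Z x ^ 2 + 2 * ∑ i, Z x * Y i x) + ∑ i, ∑ j, Y i x * Y j x := fun x => by
    rw [← Finset.mul_sum, ← Finset.sum_mul_sum]; ring
  have h1 : ∀ i, Integrable (fun x => Z x * Y i x) P := fun i => hZ.integrable_mul (hY i)
  have h2 : ∀ i j, Integrable (fun x => Y i x * Y j x) P := fun i j => (hY i).integrable_mul (hY j)
  have h3 : Integrable (fun x => 2 * ∑ i, Z x * Y i x) P :=
    (integrable_finsetSum _ fun i _ => h1 i).const_mul 2
  have h4 : ∀ i, Integrable (fun x => ∑ j, Y i x * Y j x) P :=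
    fun i => integrable_finsetSum _ fun j _ => h2 i j
  simp_rw [he]
  have h5 : Integrable (fun x => Z x ^ 2 + 2 * ∑ i, Z x * Y i x) P := hZ.integrable_sq.add h3
  rw [integral_add h5 (integrable_finsetSum _ fun i _ => h4 i), integral_add hZ.integrable_sq h3,
    integral_const_mul, integral_finsetSum _ fun i _ => h1 i, integral_finsetSum _ fun i _ => h4 i]
  simp only [hZY, Finset.sum_const_zero, mul_zero, add_zero, add_right_inj]
  refine Finset.sum_congr rfl fun i _ => ?_
  rw [integral_finsetSum _ fun j _ => h2 i j, Finset.sum_eq_single i]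
  · simp [sq]
  · exact fun j _ hj => hYY i j hj.symm
  · simp

end Product

section Data

variable {S A : Type*} [Fintype S] [MeasurableSpace S] [DiscreteMeasurableSpace S]
  [MeasurableSpace A] {ν : Measure A} {H n : ℕ}

instance (M : EpisodicMDP S A) (p : Policy S A ν) (H n : ℕ) :
    IsProbabilityMeasure (dataLaw M p H n) := by
  unfold dataLaw; infer_instance

/-- The quantity depends only on the data up to time `t`. -/
def Adapted (t : ℕ) (f : (Fin n → Traj S A H) → ℝ) : Prop :=
  ∀ D D', (∀ i, AgreeUpTo t (D i) (D' i)) → f D = f D'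

theorem Adapted.mono {t t' : ℕ} (h : t' ≤ t) {f : (Fin n → Traj S A H) → ℝ} (hf : Adapted t' f) :
    Adapted t f :=
  fun D D' hD => hf D D' fun i => (hD i).mono h

theorem Adapted.update {t : ℕ} {f : (Fin n → Traj S A H) → ℝ} (hf : Adapted t f) (i : Fin n)
    (D : Fin n → Traj S A H) {τ τ' : Traj S A H} (h : AgreeUpTo t τ τ') :
    f (Function.update D i τ) = f (Function.update D i τ') := by
  refine hf _ _ fun j => ?_
  by_cases hj : j = i
  · subst hj; simpa using h
  · simpa [hj] using AgreeUpTo.refl t (D j)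

theorem Adapted.mul {t : ℕ} {f g : (Fin n → Traj S A H) → ℝ} (hf : Adapted t f)
    (hg : Adapted t g) : Adapted t fun D => f D * g D :=
  fun D D' h => by simp only [hf D D' h, hg D D' h]

theorem Adapted.sum {ι : Type*} {s : Finset ι} {t : ℕ} {f : ι → (Fin n → Traj S A H) → ℝ}
    (hf : ∀ k ∈ s, Adapted t (f k)) : Adapted t fun D => ∑ k ∈ s, f k D :=
  fun D D' h => Finset.sum_congr rfl fun k hk => hf k hk D D' h

theorem measurable_state_stepAt {φ : S → (A × S) × ℝ → ℝ} (hφ : ∀ s, Measurable (φ s))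
    (t : Fin H) : Measurable fun τ : Traj S A H => φ (τ.1 t.castSucc) (stepAt t τ) :=
  (measurable_from_prod_countable_right (f := fun x : S × ((A × S) × ℝ) => φ x.1 x.2) hφ).comp
    ((by fun_prop : Measurable fun τ : Traj S A H => τ.1 t.castSucc).prodMk (measurable_stepAt t))

/-- The prefactor must ignore only the future of episode `i`; it may use the other episodes in full.
This freedom is what kills the cross terms between two episodes at the same time. -/
theorem integral_mul_stepAt_dataLaw_eq_zero (M : EpisodicMDP S A) (p : Policy S A ν) (t : Fin H)
    (i : Fin n) {G : (Fin n → Traj S A H) → ℝ} (hG : Measurable G)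
    (hd : ∀ D τ τ', AgreeUpTo t τ τ' → G (Function.update D i τ) = G (Function.update D i τ'))
    {φ : S → (A × S) × ℝ → ℝ} (hφ : ∀ s, Measurable (φ s))
    (h0 : ∀ s, ∫ x, φ s x ∂(step M p t s) = 0) :
    ∫ D, G D * φ ((D i).1 t.castSucc) (stepAt t (D i)) ∂(dataLaw M p H n) = 0 := by
  refine integral_eq_zero_of_update _ i
    (hG.mul ((measurable_state_stepAt hφ t).comp (measurable_pi_apply i))) fun D => ?_
  simp only [Function.update_self]
  exact integral_mul_stepAt_eq_zero M p t (hG.comp (measurable_update D)) (hd D) hφ h0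

theorem measurePreserving_episode (M : EpisodicMDP S A) (p : Policy S A ν) (i : Fin n) :
    MeasurePreserving (fun D : Fin n → Traj S A H => D i) (dataLaw M p H n) (rollout M p H) :=
  measurePreserving_eval (fun _ => rollout M p H) i

theorem memLp_mul_of_bound {Ω : Type*} [MeasurableSpace Ω] {P : Measure Ω} {w f : Ω → ℝ}
    (hw : Measurable w) {B : ℝ} (hB : ∀ x, |w x| ≤ B) (hf : MemLp f 2 P) :
    MemLp (fun x => w x * f x) 2 P :=
  MemLp.of_le_mul (c := B) hf (hw.aestronglyMeasurable.mul hf.1) (ae_of_all _ fun x => by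
    rw [norm_mul]
    exact mul_le_mul_of_nonneg_right (hB x) (norm_nonneg _))

/-- Adding conditionally centered, conditionally independent increments at time `t` to a quantity
that is known at time `t` adds up the second moments. -/
theorem integral_sq_add_increment (M : EpisodicMDP S A) (p : Policy S A ν) (t : Fin H)
    {Z : (Fin n → Traj S A H) → ℝ} (hZm : Measurable Z) (hZ : MemLp Z 2 (dataLaw M p H n))
    (hZa : Adapted t Z) {w : Fin n → (Fin n → Traj S A H) → ℝ} (hwm : ∀ i, Measurable (w i))
    {B : ℝ} (hwB : ∀ i D, |w i D| ≤ B) (hwa : ∀ i, Adapted t (w i))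
    {φ : S → (A × S) × ℝ → ℝ} (hφ : ∀ s, Measurable (φ s))
    (hφ2 : MemLp (fun τ => φ (τ.1 t.castSucc) (stepAt t τ)) 2 (rollout M p H))
    (hφs : ∀ s, Integrable (fun x => φ s x ^ 2) (step M p t s))
    (h0 : ∀ s, ∫ x, φ s x ∂(step M p t s) = 0) :
    ∫ D, (Z D + ∑ i, w i D * φ ((D i).1 t.castSucc) (stepAt t (D i))) ^ 2 ∂(dataLaw M p H n) =
      ∫ D, Z D ^ 2 ∂(dataLaw M p H n) +
        ∫ D, ∑ i, w i D ^ 2 * ∫ x, φ ((D i).1 t.castSucc) x ^ 2 ∂(step M p t ((D i).1 t.castSucc))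
          ∂(dataLaw M p H n) := by
  have hφm : ∀ i, Measurable fun D : Fin n → Traj S A H =>
      φ ((D i).1 t.castSucc) (stepAt t (D i)) :=
    fun i => (measurable_state_stepAt hφ t).comp (measurable_pi_apply i)
  have hφL : ∀ i, MemLp (fun D : Fin n → Traj S A H =>
      φ ((D i).1 t.castSucc) (stepAt t (D i))) 2 (dataLaw M p H n) :=
    fun i => hφ2.comp_measurePreserving (measurePreserving_episode M p i)
  have hY : ∀ i, MemLp (fun D : Fin n → Traj S A H =>
      w i D * φ ((D i).1 t.castSucc) (stepAt t (D i))) 2 (dataLaw M p H n) :=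
    fun i => memLp_mul_of_bound (hwm i) (hwB i) (hφL i)
  have hqm : Measurable fun s => ∫ x, φ s x ^ 2 ∂(step M p t s) := Measurable.of_discrete
  have hq1 : ∀ i, Integrable (fun D : Fin n → Traj S A H => w i D ^ 2 *
      ∫ x, φ ((D i).1 t.castSucc) x ^ 2 ∂(step M p t ((D i).1 t.castSucc)))
        (dataLaw M p H n) := fun i => by
    refine Integrable.of_bound (((hwm i).pow_const 2).mul
      (hqm.comp (by fun_prop))).aestronglyMeasurable
      (B ^ 2 * ∑ s, |∫ x, φ s x ^ 2 ∂(step M p t s)|) (ae_of_all _ fun D => ?_)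
    rw [norm_mul, norm_pow]
    refine mul_le_mul (pow_le_pow_left₀ (norm_nonneg _) (hwB i D) 2) ?_ (norm_nonneg _)
      (sq_nonneg _)
    exact Finset.single_le_sum (f := fun s => |∫ x, φ s x ^ 2 ∂(step M p t s)|)
      (fun s _ => abs_nonneg _) (Finset.mem_univ ((D i).1 t.castSucc))
  rw [integral_sq_add_sum hZ hY, add_right_inj, integral_finsetSum _ fun i _ => hq1 i]
  · refine Finset.sum_congr rfl fun i _ => ?_
    rw [← sub_eq_zero, ← integral_sub (hY i).integrable_sq (hq1 i)]
    -- The diagonal terms use the same orthogonality, applied to `φ²` minus its conditional mean.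
    have := integral_mul_stepAt_dataLaw_eq_zero M p t i ((hwm i).pow_const 2)
      (fun D τ τ' h => by simp only [(hwa i).update i D h])
      (φ := fun s x => φ s x ^ 2 - ∫ x, φ s x ^ 2 ∂(step M p t s))
      (fun s => ((hφ s).pow_const 2).sub_const _) (fun s => by
        rw [integral_sub (hφs s) (integrable_const _)]; simp)
    rw [← this]
    exact integral_congr_ae (ae_of_all _ fun D => by ring)
  · intro i
    have := integral_mul_stepAt_dataLaw_eq_zero M p t i (hZm.mul (hwm i))
      (fun D τ τ' h => by simp only [Pi.mul_apply, hZa.update i D h, (hwa i).update i D h]) hφ h0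
    rw [← this]
    exact integral_congr_ae (ae_of_all _ fun D => by simp only [Pi.mul_apply]; ring)
  -- The step of episode `j` goes into the prefactor; it does not change when episode `i` is
  -- updated.
  · intro j i hji
    have := integral_mul_stepAt_dataLaw_eq_zero M p t i (((hwm j).mul (hφm j)).mul (hwm i))
      (fun D τ τ' h => by
        simp only [Pi.mul_apply, (hwa j).update i D h, (hwa i).update i D h,
          Function.update_of_ne hji]) hφ h0
    rw [← this]
    exact integral_congr_ae (ae_of_all _ fun D => by simp only [Pi.mul_apply]; ring)

end Data

/-! ### The estimator as a sum of increments -/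

section Estimator

variable {S A : Type*} [Fintype S] [MeasurableSpace S] [DiscreteMeasurableSpace S]
  [MeasurableSpace A] {ν : Measure A} {H n : ℕ}

theorem visits_nonneg (D : Fin n → Traj S A H) (t : Fin (H + 1)) (s : S) : 0 ≤ visits D t s :=
  Finset.sum_nonneg fun i _ => by split_ifs <;> simp

theorem visits_le (D : Fin n → Traj S A H) (t : Fin (H + 1)) (s : S) : visits D t s ≤ n := by
  calc visits D t s ≤ ∑ _i : Fin n, (1 : ℝ) :=
        Finset.sum_le_sum fun i _ => by split_ifs <;> simp
    _ = n := by simp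

theorem one_le_visits (D : Fin n → Traj S A H) (t : Fin (H + 1)) (i : Fin n) :
    1 ≤ visits D t ((D i).1 t) := by
  classical
  refine le_trans (by simp) (Finset.single_le_sum
    (f := fun j => if (D j).1 t = (D i).1 t then (1 : ℝ) else 0)
    (fun j _ => by positivity) (Finset.mem_univ i)) |>.trans (le_of_eq ?_)
  exact Finset.sum_congr rfl fun j _ => by congr

theorem measurableSet_state (i : Fin n) (t : Fin (H + 1)) (s : S) :
    MeasurableSet {D : Fin n → Traj S A H | (D i).1 t = s} :=
  (by fun_prop : Measurable fun D : Fin n → Traj S A H => (D i).1 t) (measurableSet_singleton s)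

theorem measurable_visits (t : Fin (H + 1)) (s : S) :
    Measurable fun D : Fin n → Traj S A H => visits D t s :=
  Finset.measurable_sum _ fun i _ =>
    Measurable.ite (measurableSet_state i t s) measurable_const measurable_const

theorem measurable_transHat (π μ : Policy S A ν) (t : Fin H) (s s' : S) :
    Measurable fun D : Fin n → Traj S A H => transHat π μ D t s s' := by
  refine ((measurable_visits _ s).const_div 1).mul (Finset.measurable_sum _ fun i _ => ?_)
  refine Measurable.ite ((measurableSet_state i _ s).inter (measurableSet_state i _ s')) ?_
    measurable_const
  exact (measurable_weight_action π μ t s).comp (by fun_prop)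

theorem measurable_rewardHat (π μ : Policy S A ν) (t : Fin H) (s : S) :
    Measurable fun D : Fin n → Traj S A H => rewardHat π μ D t s := by
  refine ((measurable_visits _ s).const_div 1).mul (Finset.measurable_sum _ fun i _ => ?_)
  refine Measurable.ite (measurableSet_state i _ s) ?_ measurable_const
  exact ((measurable_weight_action π μ t s).comp (by fun_prop)).mul (by fun_prop)

theorem distHat_zero (π μ : Policy S A ν) (D : Fin n → Traj S A H) (s : S) :
    distHat π μ D 0 s = visits D 0 s / n := rfl

theorem distHat_succ (π μ : Policy S A ν) (D : Fin n → Traj S A H) (t : Fin H) (s' : S) :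
    distHat π μ D t.succ s' = ∑ s, transHat π μ D t s s' * distHat π μ D t.castSucc s := rfl

theorem measurable_distHat (π μ : Policy S A ν) (t : Fin (H + 1)) (s : S) :
    Measurable fun D : Fin n → Traj S A H => distHat π μ D t s := by
  induction t using Fin.induction generalizing s with
  | zero => exact (measurable_visits 0 s).div_const _
  | succ t ih =>
    simp only [distHat_succ]
    exact Finset.measurable_sum _ fun s' _ => (measurable_transHat π μ t s' s).mul (ih s')

theorem visits_congr {t : ℕ} {u : Fin (H + 1)} (hu : (u : ℕ) ≤ t) (s : S)
    {D D' : Fin n → Traj S A H} (h : ∀ i, AgreeUpTo t (D i) (D' i)) :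
    visits D u s = visits D' u s :=
  Finset.sum_congr rfl fun i _ => by rw [(h i).1 u hu]

theorem adapted_transHat (π μ : Policy S A ν) (t : Fin H) (s s' : S) :
    Adapted (t + 1) fun D : Fin n → Traj S A H => transHat π μ D t s s' := by
  intro D D' h
  simp only [transHat]
  rw [visits_congr (Nat.le_succ t : (t.castSucc : ℕ) ≤ t + 1) s h]
  congr 1
  refine Finset.sum_congr rfl fun i _ => ?_
  rw [(h i).1 t.castSucc (Nat.le_succ _), (h i).1 t.succ le_rfl, (h i).2 t (Nat.lt_succ_self _)]

theorem adapted_distHat (π μ : Policy S A ν) (t : Fin (H + 1)) (s : S) :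
    Adapted t fun D : Fin n → Traj S A H => distHat π μ D t s := by
  induction t using Fin.induction generalizing s with
  | zero =>
    intro D D' h
    simp only [distHat_zero, visits_congr (u := (0 : Fin (H + 1))) le_rfl s h]
  | succ t ih =>
    simp only [distHat_succ]
    exact Adapted.sum fun s' _ =>
      (adapted_transHat π μ t s' s).mul ((ih s').mono (Nat.le_succ _))

theorem distHat_congr (π μ : Policy S A ν) {t : ℕ} {u : Fin (H + 1)} (hu : (u : ℕ) ≤ t) (s : S)
    {D D' : Fin n → Traj S A H} (h : ∀ i, AgreeUpTo t (D i) (D' i)) :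
    distHat π μ D u s = distHat π μ D' u s :=
  adapted_distHat π μ u s D D' fun i => (h i).mono hu

theorem abs_transHat_le {π μ : Policy S A ν} (hw : BoundedWeights π μ H)
    (D : Fin n → Traj S A H) (t : Fin H) (s s' : S) : |transHat π μ D t s s'| ≤ tauA π μ H := by
  have hτ : 0 ≤ tauA π μ H := Real.iSup_nonneg fun x => weight_nonneg _ _ _ _ _
  have h1 : |transHat π μ D t s s'| ≤
      (1 / visits D t.castSucc s) * (visits D t.castSucc s * tauA π μ H) := by
    unfold transHat
    rw [abs_mul, abs_of_nonneg (one_div_nonneg.2 (visits_nonneg D _ s))]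
    refine mul_le_mul_of_nonneg_left ?_ (one_div_nonneg.2 (visits_nonneg D _ s))
    refine (Finset.abs_sum_le_sum_abs _ _).trans ?_
    rw [visits, Finset.sum_mul]
    refine Finset.sum_le_sum fun i _ => ?_
    by_cases h : (D i).1 t.castSucc = s
    · simp only [h, true_and, if_true, one_mul]
      split_ifs
      · rw [abs_of_nonneg (weight_nonneg _ _ _ _ _)]
        exact weight_le_tauA hw t.isLt s _
      · simpa using hτ
    · simp [h]
  refine h1.trans ?_
  rcases eq_or_ne (visits D t.castSucc s) 0 with h | h
  · simpa [h] using hτ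
  · field_simp
    exact le_rfl

/-- A crude bound that grows with the number of states. It serves integrability only and never
enters the final estimate. -/
theorem exists_abs_distHat_le {π μ : Policy S A ν} (hw : BoundedWeights π μ H) (n : ℕ)
    (t : Fin (H + 1)) :
    ∃ B : ℝ, 0 ≤ B ∧ ∀ (D : Fin n → Traj S A H) (s : S), |distHat π μ D t s| ≤ B := by
  induction t using Fin.induction with
  | zero =>
    refine ⟨1, zero_le_one, fun D s => ?_⟩
    rw [distHat_zero, abs_of_nonneg (div_nonneg (visits_nonneg D 0 s) n.cast_nonneg)]
    exact div_le_one_of_le₀ (visits_le D 0 s) n.cast_nonneg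
  | succ t ih =>
    obtain ⟨B, hB, h⟩ := ih
    have hτ : 0 ≤ tauA π μ H := Real.iSup_nonneg fun x => weight_nonneg _ _ _ _ _
    refine ⟨∑ _s : S, tauA π μ H * B, Finset.sum_nonneg fun _ _ => mul_nonneg hτ hB,
      fun D s => ?_⟩
    rw [distHat_succ]
    refine (Finset.abs_sum_le_sum_abs _ _).trans (Finset.sum_le_sum fun s' _ => ?_)
    rw [abs_mul]
    exact mul_le_mul (abs_transHat_le hw D t s' s) (h D s') (abs_nonneg _) hτ

/-- Up to time `t`, every state with a nonzero estimated probability is visited, and is visited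
(except at the initial time) at least half as often as expected. -/
def Good (M : EpisodicMDP S A) (π μ : Policy S A ν) (t : Fin H) (D : Fin n → Traj S A H) : Prop :=
  ∀ u ≤ t, ∀ s, distHat π μ D u.castSucc s = 0 ∨ (0 < visits D u.castSucc s ∧
    ((u : ℕ) = 0 ∨ n * stateDist M μ u s / 2 ≤ visits D u.castSucc s))

theorem Good.mono {M : EpisodicMDP S A} {π μ : Policy S A ν} {t u : Fin H}
    {D : Fin n → Traj S A H} (h : Good M π μ t D) (hu : u ≤ t) : Good M π μ u D :=
  fun v hv => h v (hv.trans hu)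

theorem measurableSet_good (M : EpisodicMDP S A) (π μ : Policy S A ν) (t : Fin H) :
    MeasurableSet {D : Fin n → Traj S A H | Good M π μ t D} := by
  have : {D : Fin n → Traj S A H | Good M π μ t D} = ⋂ u : Fin H, ⋂ _ : u ≤ t, ⋂ s,
      ({D | distHat π μ D u.castSucc s = 0} ∪ ({D | 0 < visits D u.castSucc s} ∩
        ({_D | (u : ℕ) = 0} ∪ {D | n * stateDist M μ u s / 2 ≤ visits D u.castSucc s}))) := by
    ext D; simp [Good]
  rw [this]
  refine MeasurableSet.iInter fun u => MeasurableSet.iInter fun _ => MeasurableSet.iInter fun s =>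
    ((measurable_distHat π μ _ s) (measurableSet_singleton 0)).union
      ((measurableSet_lt measurable_const (measurable_visits _ s)).inter
        ((MeasurableSet.const _).union (measurableSet_le measurable_const (measurable_visits _ s))))

theorem good_iff_of_agree (M : EpisodicMDP S A) (π μ : Policy S A ν) (t : Fin H)
    {D D' : Fin n → Traj S A H} (h : ∀ i, AgreeUpTo t (D i) (D' i)) :
    Good M π μ t D ↔ Good M π μ t D' := by
  refine forall₃_congr fun u hu s => ?_
  have hu' : (u.castSucc : ℕ) ≤ t := hu
  rw [distHat_congr π μ hu' s h, visits_congr hu' s h]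

open Classical in
/-- The estimated state distribution at time `t`, or `0` off the good event. -/
def goodDist (M : EpisodicMDP S A) (π μ : Policy S A ν) (t : Fin H) (s : S)
    (D : Fin n → Traj S A H) : ℝ :=
  if Good M π μ t D then distHat π μ D t.castSucc s else 0

theorem measurable_goodDist (M : EpisodicMDP S A) (π μ : Policy S A ν) (t : Fin H) (s : S) :
    Measurable (goodDist M π μ t s : (Fin n → Traj S A H) → ℝ) :=
  Measurable.ite (measurableSet_good M π μ t) (measurable_distHat π μ _ s) measurable_const

theorem adapted_goodDist (M : EpisodicMDP S A) (π μ : Policy S A ν) (t : Fin H) (s : S) :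
    Adapted t (goodDist M π μ t s : (Fin n → Traj S A H) → ℝ) := by
  intro D D' h
  unfold goodDist
  rw [distHat_congr π μ (le_refl (t.castSucc : ℕ)) s h]
  have hG := good_iff_of_agree M π μ t h
  by_cases hD : Good M π μ t D'
  · rw [if_pos hD, if_pos (hG.2 hD)]
  · rw [if_neg hD, if_neg fun h' => hD (hG.1 h')]

theorem exists_abs_goodDist_le (M : EpisodicMDP S A) {π μ : Policy S A ν}
    (hw : BoundedWeights π μ H) (n : ℕ) (t : Fin H) :
    ∃ B : ℝ, 0 ≤ B ∧ ∀ (D : Fin n → Traj S A H) (s : S), |goodDist M π μ t s D| ≤ B := by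
  obtain ⟨B, hB, h⟩ := exists_abs_distHat_le hw n t.castSucc
  refine ⟨B, hB, fun D s => ?_⟩
  unfold goodDist
  split_ifs
  · exact h D s
  · simpa using hB

/-- The weight of the `i`-th episode in the increment at time `t`. -/
def incrWeight (M : EpisodicMDP S A) (π μ : Policy S A ν) (t : Fin H) (i : Fin n)
    (D : Fin n → Traj S A H) : ℝ :=
  goodDist M π μ t ((D i).1 t.castSucc) D / visits D t.castSucc ((D i).1 t.castSucc)

theorem measurable_incrWeight (M : EpisodicMDP S A) (π μ : Policy S A ν) (t : Fin H) (i : Fin n) :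
    Measurable (incrWeight M π μ t i : (Fin n → Traj S A H) → ℝ) := by
  have h : Measurable fun x : S × (Fin n → Traj S A H) =>
      goodDist M π μ t x.1 x.2 / visits x.2 t.castSucc x.1 :=
    measurable_from_prod_countable_right fun s =>
      (measurable_goodDist M π μ t s).div (measurable_visits _ s)
  have h' : Measurable fun D : Fin n → Traj S A H => (D i).1 t.castSucc := by fun_prop
  have h'' : Measurable fun D : Fin n → Traj S A H => ((D i).1 t.castSucc, D) :=
    h'.prodMk measurable_id
  have e : (incrWeight M π μ t i : (Fin n → Traj S A H) → ℝ) =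
      (fun x : S × (Fin n → Traj S A H) => goodDist M π μ t x.1 x.2 / visits x.2 t.castSucc x.1) ∘
        fun D => ((D i).1 t.castSucc, D) := by
    funext D
    rw [Function.comp_apply, incrWeight]
  rw [e]
  exact h.comp h''

theorem adapted_incrWeight (M : EpisodicMDP S A) (π μ : Policy S A ν) (t : Fin H) (i : Fin n) :
    Adapted t (incrWeight M π μ t i : (Fin n → Traj S A H) → ℝ) := by
  intro D D' h
  unfold incrWeight
  rw [(h i).1 t.castSucc le_rfl, adapted_goodDist M π μ t _ D D' h,
    visits_congr (le_refl (t.castSucc : ℕ)) _ h]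

theorem exists_abs_incrWeight_le (M : EpisodicMDP S A) {π μ : Policy S A ν}
    (hw : BoundedWeights π μ H) (n : ℕ) (t : Fin H) :
    ∃ B : ℝ, ∀ (i : Fin n) (D : Fin n → Traj S A H), |incrWeight M π μ t i D| ≤ B := by
  obtain ⟨B, hB, h⟩ := exists_abs_goodDist_le M hw n t
  refine ⟨B, fun i D => ?_⟩
  have h1 := one_le_visits D t.castSucc i
  rw [incrWeight, abs_div, abs_of_nonneg (visits_nonneg D _ _)]
  exact (div_le_self (abs_nonneg _) h1).trans (h D _)

open Classical in
theorem sum_mul_sum_ite {ι : Type*} [Fintype ι] (x : ι → S) (d N : S → ℝ) (g : S → ι → ℝ) :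
    ∑ s, d s * ((1 / N s) * ∑ i, if x i = s then g s i else 0) =
      ∑ i, d (x i) / N (x i) * g (x i) i := by
  simp_rw [Finset.mul_sum]
  rw [Finset.sum_comm]
  refine Finset.sum_congr rfl fun i _ => ?_
  rw [Finset.sum_eq_single (x i)]
  · simp only [if_true]; ring
  · intro s _ hs
    rw [if_neg hs.symm]; ring
  · simp

/-- The `n_{t,s}` episodes in state `s` each contribute `(d̂ / n_{t,s})²`, so one power of the count
survives in the denominator. -/
theorem sum_incrWeight_sq_mul (M : EpisodicMDP S A) (π μ : Policy S A ν) (t : Fin H)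
    (D : Fin n → Traj S A H) (q : S → ℝ) :
    ∑ i, incrWeight M π μ t i D ^ 2 * q ((D i).1 t.castSucc) =
      ∑ s, goodDist M π μ t s D ^ 2 / visits D t.castSucc s * q s := by
  classical
  have h := sum_mul_sum_ite (fun i => (D i).1 t.castSucc) (fun s => goodDist M π μ t s D)
    (fun s => visits D t.castSucc s)
    (fun s _ => goodDist M π μ t s D / visits D t.castSucc s * q s)
  calc _ = ∑ i, goodDist M π μ t ((D i).1 t.castSucc) D /
        visits D t.castSucc ((D i).1 t.castSucc) *
        (goodDist M π μ t ((D i).1 t.castSucc) D / visits D t.castSucc ((D i).1 t.castSucc) *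
          q ((D i).1 t.castSucc)) := Finset.sum_congr rfl fun i _ => by rw [incrWeight]; ring
    _ = _ := h.symm
    _ = _ := by
      refine Finset.sum_congr rfl fun s _ => ?_
      have h1 : (∑ i, if (D i).1 t.castSucc = s then
          goodDist M π μ t s D / visits D t.castSucc s * q s else 0) =
          visits D t.castSucc s * (goodDist M π μ t s D / visits D t.castSucc s * q s) := by
        rw [visits, Finset.sum_mul]
        exact Finset.sum_congr rfl fun i _ => by split_ifs <;> simp
      rw [h1]
      rcases eq_or_ne (visits D t.castSucc s) 0 with h0 | h0
      · simp [h0]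
      · field_simp

/-- The weighted one-step return minus its mean. -/
def centered (π μ : Policy S A ν) (κ : ℝ) (W : ℕ → S → ℝ) (t : ℕ) (s : S) (x : (A × S) × ℝ) : ℝ :=
  weight π μ t s x.1.1 * (κ * x.2 + W (t + 1) x.1.2) - W t s

/-- The increment at time `t`. -/
def increment (M : EpisodicMDP S A) (π μ : Policy S A ν) (κ : ℝ) (W : ℕ → S → ℝ) (t : Fin H)
    (D : Fin n → Traj S A H) : ℝ :=
  ∑ i, incrWeight M π μ t i D * centered π μ κ W t ((D i).1 t.castSucc) (stepAt t (D i))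

/-- The estimate of the `κ`-scaled rewards before time `t` and of the value `W` at time `t`. -/
def partialEst (π μ : Policy S A ν) (κ : ℝ) (W : ℕ → S → ℝ) (t : Fin (H + 1))
    (D : Fin n → Traj S A H) : ℝ :=
  κ * (∑ u : Fin H, if u.castSucc < t then
    ∑ s, distHat π μ D u.castSucc s * rewardHat π μ D u s else 0) +
    ∑ s, distHat π μ D t s * W t s

theorem sum_ite_lt_succ (f : Fin H → ℝ) (t : Fin H) :
    (∑ u : Fin H, if u.castSucc < t.succ then f u else 0) =
      (∑ u : Fin H, if u.castSucc < t.castSucc then f u else 0) + f t := by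
  have h : ∀ u : Fin H, (if u.castSucc < t.succ then f u else 0) =
      (if u.castSucc < t.castSucc then f u else 0) + if u = t then f u else 0 := fun u => by
    rcases lt_trichotomy u t with h | h | h
    · simp [h.ne, Fin.castSucc_lt_succ_iff, h, h.le]
    · simp [h, Fin.castSucc_lt_succ_iff]
    · simp [h.ne', Fin.castSucc_lt_succ_iff, h.not_gt, h.not_ge]
  simp_rw [h]
  rw [Finset.sum_add_distrib]
  simp

/-- Sums over states are regrouped as sums over episodes. The rewards and the value at `t + 1`
regroup unconditionally; the subtracted value at `t` needs the good event. -/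
theorem partialEst_succ {M : EpisodicMDP S A} {π μ : Policy S A ν} (κ : ℝ) (W : ℕ → S → ℝ)
    {t : Fin H} {D : Fin n → Traj S A H} (hD : Good M π μ t D) :
    partialEst π μ κ W t.succ D = partialEst π μ κ W t.castSucc D + increment M π μ κ W t D := by
  classical
  let x : Fin n → S := fun i => (D i).1 t.castSucc
  let d : S → ℝ := fun s => distHat π μ D t.castSucc s
  let N : S → ℝ := fun s => visits D t.castSucc s
  have h1 : ∑ s, d s * rewardHat π μ D t s =
      ∑ i, d (x i) / N (x i) * (weight π μ t (x i) ((D i).2 t).1 * ((D i).2 t).2) := by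
    rw [← sum_mul_sum_ite x d N fun s i => weight π μ t s ((D i).2 t).1 * ((D i).2 t).2]
    rfl
  have h2 : ∑ s', distHat π μ D t.succ s' * W (t + 1) s' =
      ∑ i, d (x i) / N (x i) * (weight π μ t (x i) ((D i).2 t).1 *
        W (t + 1) ((D i).1 t.succ)) := by
    rw [← sum_mul_sum_ite x d N fun s i =>
      weight π μ t s ((D i).2 t).1 * W (t + 1) ((D i).1 t.succ)]
    simp_rw [distHat_succ, Finset.sum_mul]
    rw [Finset.sum_comm]
    refine Finset.sum_congr rfl fun s _ => ?_
    simp_rw [transHat]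
    have : ∀ s', (1 / N s * ∑ i, if x i = s ∧ (D i).1 t.succ = s' then
        weight π μ t s ((D i).2 t).1 else 0) * d s * W (t + 1) s' =
        d s * (1 / N s * ∑ i, if x i = s then (if (D i).1 t.succ = s' then
          weight π μ t s ((D i).2 t).1 * W (t + 1) s' else 0) else 0) := fun s' => by
      rw [mul_comm _ (d s), mul_assoc, mul_assoc, Finset.sum_mul]
      congr 2
      refine Finset.sum_congr rfl fun i _ => ?_
      by_cases h : x i = s <;> simp [h]
    refine (Finset.sum_congr rfl fun s' _ => this s').trans ?_
    rw [← Finset.mul_sum, ← Finset.mul_sum, Finset.sum_comm]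
    congr 2
    refine Finset.sum_congr rfl fun i _ => ?_
    by_cases h : x i = s <;> simp [h]
  have h3 : ∑ s, d s * W t s = ∑ i, d (x i) / N (x i) * W t (x i) := by
    rw [← sum_mul_sum_ite x d N fun s _ => W t s]
    refine Finset.sum_congr rfl fun s _ => ?_
    have h4 : (∑ i, if x i = s then W t s else 0) = N s * W t s := by
      simp only [N, visits, Finset.sum_mul]
      exact Finset.sum_congr rfl fun i _ => by split_ifs <;> simp_all [x]
    rw [h4]
    -- An unvisited state would lose its term `d̂ W` when written through episodes; on the good
    -- event such a state has `d̂ = 0`.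
    rcases hD t le_rfl s with h | ⟨h, -⟩
    · simp [d, h]
    · have : N s ≠ 0 := h.ne'
      field_simp
  have h5 : increment M π μ κ W t D = κ * ∑ s, d s * rewardHat π μ D t s +
      ∑ s', distHat π μ D t.succ s' * W (t + 1) s' - ∑ s, d s * W t s := by
    rw [h1, h2, h3, Finset.mul_sum, ← Finset.sum_add_distrib, ← Finset.sum_sub_distrib]
    refine Finset.sum_congr rfl fun i _ => ?_
    simp only [incrWeight, goodDist, if_pos hD, centered, stepAt, x, d, N]
    ring
  rw [h5]
  unfold partialEst
  rw [sum_ite_lt_succ]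
  simp only [Fin.val_succ, Fin.val_castSucc, d]
  ring

theorem partialEst_eq_add_sum {M : EpisodicMDP S A} {π μ : Policy S A ν} (κ : ℝ) (W : ℕ → S → ℝ)
    (T : Fin (H + 1)) {D : Fin n → Traj S A H}
    (hD : ∀ t : Fin H, t.castSucc < T → Good M π μ t D) :
    partialEst π μ κ W T D = partialEst π μ κ W 0 D +
      ∑ t : Fin H, if t.castSucc < T then increment M π μ κ W t D else 0 := by
  induction T using Fin.induction with
  | zero => simp
  | succ T ih =>
    rw [sum_ite_lt_succ, partialEst_succ κ W (hD T T.castSucc_lt_succ),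
      ih fun t ht => hD t (ht.trans T.castSucc_lt_succ), add_assoc]

end Estimator

/-! ### Second moments -/

section SecondMoment

variable {S A : Type*} [Fintype S] [MeasurableSpace S] [DiscreteMeasurableSpace S]
  [MeasurableSpace A] {ν : Measure A} {H n : ℕ}

theorem exists_abs_le (f : S → ℝ) : ∃ B, ∀ s, |f s| ≤ B :=
  ⟨∑ s, |f s|, fun s => Finset.single_le_sum (f := fun s => |f s|) (fun _ _ => abs_nonneg _)
    (Finset.mem_univ s)⟩

theorem measurable_return (π μ : Policy S A ν) (κ : ℝ) (f : S → ℝ) (t : ℕ) (s : S) :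
    Measurable fun x : (A × S) × ℝ => weight π μ t s x.1.1 * (κ * x.2 + f x.1.2) := by
  have hf : Measurable f := Measurable.of_discrete
  exact (measurable_weight_step π μ t s).mul (by fun_prop)

theorem measurable_centered (π μ : Policy S A ν) (κ : ℝ) (W : ℕ → S → ℝ) (t : ℕ) (s : S) :
    Measurable (centered π μ κ W t s) :=
  (measurable_return π μ κ (W (t + 1)) t s).sub_const _

section Fixed

variable {M : EpisodicMDP S A} {π μ : Policy S A ν} {Rmax σ : ℝ}

theorem memLp_return_step (hr : BoundedRewards M H Rmax σ) (hw : BoundedWeights π μ H) (κ : ℝ)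
    (f : S → ℝ) {t : ℕ} (ht : t < H) (s : S) :
    MemLp (fun x : (A × S) × ℝ => weight π μ t s x.1.1 * (κ * x.2 + f x.1.2)) 2
      (step M μ t s) := by
  obtain ⟨B, hB⟩ := exists_abs_le f
  have hf : Measurable f := Measurable.of_discrete
  refine memLp_mul_of_bound (measurable_weight_step π μ t s) (B := tauA π μ H) (fun x => ?_)
    (((hr.memLp_step μ ht s).const_mul κ).add (MemLp.of_bound
      (by fun_prop : Measurable fun x : (A × S) × ℝ => f x.1.2).aestronglyMeasurable B
      (ae_of_all _ fun x => hB _)))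
  rw [abs_of_nonneg (weight_nonneg _ _ _ _ _)]
  exact weight_le_tauA hw ht s _

theorem integrable_centered_sq (hr : BoundedRewards M H Rmax σ) (hw : BoundedWeights π μ H) (κ : ℝ)
    (W : ℕ → S → ℝ) {t : ℕ} (ht : t < H) (s : S) :
    Integrable (fun x => centered π μ κ W t s x ^ 2) (step M μ t s) :=
  ((memLp_return_step hr hw κ (W (t + 1)) ht s).sub (memLp_const _)).integrable_sq

theorem integral_return (hw : BoundedWeights π μ H) (κ : ℝ) (W : ℕ → S → ℝ) {t : ℕ} (ht : t < H)
    (s : S) (hW : W t s = ∫ x, (κ * x.2 + W (t + 1) x.1.2) ∂(step M π t s)) :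
    ∫ x, weight π μ t s x.1.1 * (κ * x.2 + W (t + 1) x.1.2) ∂(step M μ t s) = W t s := by
  rw [hW, integral_weight_mul_step M (hw.1 t ht s)]

theorem integral_centered (hr : BoundedRewards M H Rmax σ) (hw : BoundedWeights π μ H) (κ : ℝ)
    (W : ℕ → S → ℝ) {t : ℕ} (ht : t < H) (s : S)
    (hW : W t s = ∫ x, (κ * x.2 + W (t + 1) x.1.2) ∂(step M π t s)) :
    ∫ x, centered π μ κ W t s x ∂(step M μ t s) = 0 := by
  unfold centered
  rw [integral_sub ((memLp_return_step hr hw κ (W (t + 1)) ht s).integrable (by norm_num))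
    (integrable_const _), integral_return hw κ W ht s hW]
  simp

theorem integral_centered_sq_le (hr : BoundedRewards M H Rmax σ) (hw : BoundedWeights π μ H)
    (κ : ℝ) (W : ℕ → S → ℝ) {t : ℕ} (ht : t < H) (s : S)
    (hW : W t s = ∫ x, (κ * x.2 + W (t + 1) x.1.2) ∂(step M π t s)) :
    ∫ x, centered π μ κ W t s x ^ 2 ∂(step M μ t s) ≤ returnSq M π μ κ (W (t + 1)) t s := by
  have h2 := memLp_return_step hr hw κ (W (t + 1)) ht s
  have he : ∀ x : (A × S) × ℝ, centered π μ κ W t s x ^ 2 =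
      (weight π μ t s x.1.1 * (κ * x.2 + W (t + 1) x.1.2)) ^ 2 -
        (2 * W t s * (weight π μ t s x.1.1 * (κ * x.2 + W (t + 1) x.1.2)) - W t s ^ 2) :=
    fun x => by rw [centered]; ring
  have h3 : Integrable (fun x : (A × S) × ℝ => 2 * W t s *
      (weight π μ t s x.1.1 * (κ * x.2 + W (t + 1) x.1.2))) (step M μ t s) :=
    (h2.integrable (by norm_num)).const_mul _
  have h4 : Integrable (fun x : (A × S) × ℝ => 2 * W t s *
      (weight π μ t s x.1.1 * (κ * x.2 + W (t + 1) x.1.2)) - W t s ^ 2) (step M μ t s) :=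
    h3.sub (integrable_const _)
  simp_rw [he]
  rw [integral_sub h2.integrable_sq h4,
    integral_sub h3 (integrable_const _), integral_const_mul, integral_return hw κ W ht s hW]
  simp only [integral_const, probReal_univ, one_smul]
  rw [← returnSq]
  nlinarith [sq_nonneg (W t s)]

theorem memLp_centered_rollout (hr : BoundedRewards M H Rmax σ) (hw : BoundedWeights π μ H)
    (κ : ℝ) (W : ℕ → S → ℝ) (t : Fin H) :
    MemLp (fun τ : Traj S A H => centered π μ κ W t (τ.1 t.castSucc) (stepAt t τ)) 2
      (rollout M μ H) := by
  obtain ⟨B, hB⟩ := exists_abs_le (W (t + 1))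
  obtain ⟨B', hB'⟩ := exists_abs_le (W t)
  have hf : Measurable (W (t + 1)) := Measurable.of_discrete
  have hf' : Measurable (W t) := Measurable.of_discrete
  have hwm : Measurable fun τ : Traj S A H => weight π μ t (τ.1 t.castSucc) ((τ.2 t).1) :=
    (measurable_weight π μ t).comp (by fun_prop :
      Measurable fun τ : Traj S A H => (τ.1 t.castSucc, (τ.2 t).1))
  refine MemLp.sub (memLp_mul_of_bound hwm (B := tauA π μ H) (fun x => ?_)
    (((hr.memLp_rollout μ t).const_mul κ).add (MemLp.of_bound
      (by fun_prop : Measurable fun τ : Traj S A H => W (t + 1) (τ.1 t.succ)).aestronglyMeasurable B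
      (ae_of_all _ fun x => hB _)))) (MemLp.of_bound
      (by fun_prop : Measurable fun τ : Traj S A H => W t (τ.1 t.castSucc)).aestronglyMeasurable B'
      (ae_of_all _ fun x => hB' _))
  rw [abs_of_nonneg (weight_nonneg _ _ _ _ _)]
  exact weight_le_tauA hw t.isLt _ _

theorem measurable_increment (M : EpisodicMDP S A) (π μ : Policy S A ν) (κ : ℝ) (W : ℕ → S → ℝ)
    (t : Fin H) : Measurable (increment M π μ κ W t : (Fin n → Traj S A H) → ℝ) :=
  Finset.measurable_sum _ fun i _ => (measurable_incrWeight M π μ t i).mul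
    ((measurable_state_stepAt (measurable_centered π μ κ W t) t).comp (measurable_pi_apply i))

theorem memLp_increment (hr : BoundedRewards M H Rmax σ) (hw : BoundedWeights π μ H)
    (κ : ℝ) (W : ℕ → S → ℝ) (t : Fin H) :
    MemLp (increment M π μ κ W t) 2 (dataLaw M μ H n) := by
  obtain ⟨B, hB⟩ := exists_abs_incrWeight_le M hw n t
  unfold increment
  refine memLp_finsetSum _ fun i _ => memLp_mul_of_bound (measurable_incrWeight M π μ t i) (hB i)
    ((memLp_centered_rollout hr hw κ W t).comp_measurePreserving
      (measurePreserving_episode M μ i))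

theorem adapted_increment (M : EpisodicMDP S A) (π μ : Policy S A ν) (κ : ℝ) (W : ℕ → S → ℝ)
    (t : Fin H) : Adapted (t + 1) (increment M π μ κ W t : (Fin n → Traj S A H) → ℝ) := by
  refine Adapted.sum fun i _ => Adapted.mul ((adapted_incrWeight M π μ t i).mono (Nat.le_succ _)) ?_
  intro D D' h
  simp only [stepAt]
  rw [(h i).1 t.castSucc (Nat.le_succ _), (h i).1 t.succ le_rfl, (h i).2 t (Nat.lt_succ_self _)]

/-- The mean of `d̂_t(s)² / n_{t,s}` on the good event. -/
def meanSqDiv (M : EpisodicMDP S A) (π μ : Policy S A ν) (n : ℕ) (t : Fin H) (s : S) : ℝ :=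
  ∫ D, goodDist M π μ t s D ^ 2 / visits D t.castSucc s ∂(dataLaw M μ H n)

theorem visits_eq_zero_or (D : Fin n → Traj S A H) (t : Fin (H + 1)) (s : S) :
    visits D t s = 0 ∨ 1 ≤ visits D t s := by
  by_cases h : ∃ i, (D i).1 t = s
  · obtain ⟨i, rfl⟩ := h
    exact Or.inr (one_le_visits D t i)
  · push Not at h
    exact Or.inl (Finset.sum_eq_zero fun i _ => if_neg (h i))

theorem integrable_goodDist_sq (M : EpisodicMDP S A) {π μ : Policy S A ν}
    (hw : BoundedWeights π μ H) (n : ℕ) (t : Fin H) (s : S) :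
    Integrable (fun D => goodDist M π μ t s D ^ 2) (dataLaw M μ H n) := by
  obtain ⟨B, hB0, hB⟩ := exists_abs_goodDist_le M hw n t
  refine Integrable.of_bound ((measurable_goodDist M π μ t s).pow_const 2).aestronglyMeasurable
    (B ^ 2) (ae_of_all _ fun D => ?_)
  rw [norm_pow]
  exact pow_le_pow_left₀ (norm_nonneg _) (hB D s) 2

theorem sq_div_visits_le (D : Fin n → Traj S A H) (t : Fin (H + 1)) (s : S) (x : ℝ) :
    x ^ 2 / visits D t s ≤ x ^ 2 := by
  rcases visits_eq_zero_or D t s with h | h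
  · simp [h, sq_nonneg]
  · exact div_le_self (sq_nonneg _) h

theorem integrable_goodDist_sq_div (M : EpisodicMDP S A) {π μ : Policy S A ν}
    (hw : BoundedWeights π μ H) (n : ℕ) (t : Fin H) (s : S) :
    Integrable (fun D => goodDist M π μ t s D ^ 2 / visits D t.castSucc s) (dataLaw M μ H n) := by
  refine (integrable_goodDist_sq M hw n t s).mono' (((measurable_goodDist M π μ t s).pow_const
    2).div (measurable_visits _ s)).aestronglyMeasurable (ae_of_all _ fun D => ?_)
  rw [Real.norm_of_nonneg (div_nonneg (sq_nonneg _) (visits_nonneg D _ s))]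
  exact sq_div_visits_le D _ s _

theorem meanSqDiv_nonneg (M : EpisodicMDP S A) (π μ : Policy S A ν) (n : ℕ) (t : Fin H) (s : S) :
    0 ≤ meanSqDiv M π μ n t s :=
  integral_nonneg fun D => div_nonneg (sq_nonneg _) (visits_nonneg D _ s)

/-- The partial estimate, with the error of each step removed off the good event. -/
def goodEst (M : EpisodicMDP S A) (π μ : Policy S A ν) (κ y : ℝ) (W : ℕ → S → ℝ) (T : Fin (H + 1))
    (D : Fin n → Traj S A H) : ℝ :=
  (∑ s, distHat π μ D 0 s * W 0 s - y) +
    ∑ t : Fin H, if t.castSucc < T then increment M π μ κ W t D else 0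

theorem goodEst_succ (κ y : ℝ) (W : ℕ → S → ℝ) (t : Fin H) (D : Fin n → Traj S A H) :
    goodEst M π μ κ y W t.succ D = goodEst M π μ κ y W t.castSucc D + increment M π μ κ W t D := by
  rw [goodEst, sum_ite_lt_succ, ← add_assoc, goodEst]

theorem goodEst_zero (κ y : ℝ) (W : ℕ → S → ℝ) (D : Fin n → Traj S A H) :
    goodEst M π μ κ y W 0 D = ∑ s, distHat π μ D 0 s * W 0 s - y := by
  simp [goodEst]

theorem adapted_goodEst (κ y : ℝ) (W : ℕ → S → ℝ) (T : Fin (H + 1)) :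
    Adapted T (goodEst M π μ κ y W T : (Fin n → Traj S A H) → ℝ) := by
  induction T using Fin.induction with
  | zero =>
    intro D D' h
    simp only [goodEst_zero, distHat_congr π μ (le_refl ((0 : Fin (H + 1)) : ℕ)) _ h]
  | succ t ih =>
    intro D D' h
    rw [goodEst_succ, goodEst_succ, adapted_increment M π μ κ W t D D' h,
      ih D D' fun i => (h i).mono (Nat.le_succ _)]

theorem measurable_goodEst (κ y : ℝ) (W : ℕ → S → ℝ) (T : Fin (H + 1)) :
    Measurable (goodEst M π μ κ y W T : (Fin n → Traj S A H) → ℝ) := by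
  refine ((Finset.measurable_sum _ fun s _ =>
    (measurable_distHat π μ 0 s).mul_const _).sub_const _).add
      (Finset.measurable_sum _ fun t _ => ?_)
  split_ifs
  · exact measurable_increment M π μ κ W t
  · exact measurable_const

theorem memLp_goodEst (hr : BoundedRewards M H Rmax σ) (hw : BoundedWeights π μ H) (κ y : ℝ)
    (W : ℕ → S → ℝ) (T : Fin (H + 1)) : MemLp (goodEst M π μ κ y W T) 2 (dataLaw M μ H n) := by
  induction T using Fin.induction with
  | zero =>
    obtain ⟨B, hB0, hB⟩ := exists_abs_distHat_le hw n 0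
    have h : MemLp (fun D : Fin n → Traj S A H => ∑ s, distHat π μ D 0 s * W 0 s) 2
        (dataLaw M μ H n) := memLp_finsetSum _ fun s _ =>
      (MemLp.of_bound (measurable_distHat π μ 0 s).aestronglyMeasurable B
        (ae_of_all _ fun D => hB D s)).mul_const _
    rw [funext (goodEst_zero (M := M) κ y W)]
    exact h.sub (memLp_const y)
  | succ t ih =>
    rw [funext (goodEst_succ (M := M) κ y W t)]
    exact ih.add (memLp_increment hr hw κ W t)

theorem sum_distHat_zero_mul (D : Fin n → Traj S A H) (f : S → ℝ) :
    ∑ s, distHat π μ D 0 s * f s = ∑ i, (1 / (n : ℝ)) * f ((D i).1 0) := by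
  classical
  simp only [distHat_zero, visits, Finset.sum_div, Finset.sum_mul]
  rw [Finset.sum_comm]
  refine Finset.sum_congr rfl fun i _ => ?_
  rw [Finset.sum_eq_single ((D i).1 0)]
  · simp
  · intro s _ hs
    simp [hs.symm]
  · simp

/-- Squared bias plus variance of an empirical mean, the variance being bounded by the raw second
moment. The centering `y` is `v^π` for the error bound and `0` for the second moment of `distHat`.
-/
theorem integral_goodEst_zero_sq_le (hn : 1 ≤ n) (κ y : ℝ) (W : ℕ → S → ℝ) :
    ∫ D, goodEst M π μ κ y W (0 : Fin (H + 1)) D ^ 2 ∂(dataLaw M μ H n) ≤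
      (∑ s, stateDist M μ 0 s * W 0 s - y) ^ 2 +
        (∑ s, stateDist M μ 0 s * W 0 s ^ 2) / n := by
  set x := ∑ s, stateDist M μ 0 s * W 0 s with hx
  have hn0 : (n : ℝ) ≠ 0 := by positivity
  let g : S → ℝ := fun s => (1 / (n : ℝ)) * (W 0 s - x)
  have hg : Measurable g := Measurable.of_discrete
  obtain ⟨B, hB⟩ := exists_abs_le g
  have hint : ∀ f : S → ℝ, ∫ τ : Traj S A H, f (τ.1 0) ∂(rollout M μ H) =
      ∑ s, stateDist M μ 0 s * f s := fun f => integral_state M μ (0 : Fin (H + 1)) f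
  have hg0 : ∫ τ : Traj S A H, g (τ.1 0) ∂(rollout M μ H) = 0 := by
    rw [hint]
    have : ∀ s, stateDist M μ 0 s * g s =
        (1 / (n : ℝ)) * (stateDist M μ 0 s * W 0 s) - (1 / (n : ℝ)) * x * stateDist M μ 0 s :=
      fun s => by simp only [g]; ring
    simp_rw [this]
    rw [Finset.sum_sub_distrib, ← Finset.mul_sum, ← Finset.mul_sum, sum_stateDist, ← hx]
    ring
  have hgm : ∀ i, Measurable fun D : Fin n → Traj S A H => g ((D i).1 0) := fun i => by fun_prop
  have he : ∀ D : Fin n → Traj S A H,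
      goodEst M π μ κ y W (0 : Fin (H + 1)) D = (x - y) + ∑ i, g ((D i).1 0) := fun D => by
    rw [goodEst_zero, sum_distHat_zero_mul]
    simp only [g, mul_sub, Finset.sum_sub_distrib, Finset.sum_const, Finset.card_univ,
      Fintype.card_fin, nsmul_eq_mul]
    field_simp
    ring
  simp_rw [he]
  refine (le_of_eq (integral_sq_add_sum (P := dataLaw M μ H n) (Z := fun _ => x - y)
    (Y := fun (i : Fin n) D => g ((D i).1 0)) (memLp_const _)
    (fun i => MemLp.of_bound (hgm i).aestronglyMeasurable B (ae_of_all _ fun D => hB _))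
    (fun i => ?_) (fun i j hij => ?_))).trans ?_
  rotate_left 2
  · simp only [integral_const, probReal_univ, one_smul]
    have h1 : ∀ i : Fin n, ∫ D, g ((D i).1 0) ^ 2 ∂(dataLaw M μ H n) ≤
        (1 / (n : ℝ)) ^ 2 * ∑ s, stateDist M μ 0 s * W 0 s ^ 2 := fun i => by
      have h2 : ∫ D, g ((D i).1 0) ^ 2 ∂(dataLaw M μ H n) =
          ∫ τ : Traj S A H, g (τ.1 0) ^ 2 ∂(rollout M μ H) := by
        have h3 := measurePreserving_episode (H := H) M μ i
        rw [← h3.map_eq, integral_map h3.measurable.aemeasurable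
          (by fun_prop : Measurable _).aestronglyMeasurable]
      rw [h2, hint fun s => g s ^ 2]
      have h4 : ∀ s, stateDist M μ 0 s * g s ^ 2 = (1 / (n : ℝ)) ^ 2 *
          (stateDist M μ 0 s * W 0 s ^ 2 - 2 * x * (stateDist M μ 0 s * W 0 s) +
            x ^ 2 * stateDist M μ 0 s) := fun s => by simp only [g]; ring
      simp_rw [h4]
      rw [← Finset.mul_sum, Finset.sum_add_distrib, Finset.sum_sub_distrib, ← Finset.mul_sum,
        ← Finset.mul_sum, sum_stateDist, ← hx]
      refine mul_le_mul_of_nonneg_left ?_ (sq_nonneg _)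
      nlinarith [sq_nonneg x]
    refine add_le_add le_rfl ((Finset.sum_le_sum fun i _ => h1 i).trans (le_of_eq ?_))
    simp only [Finset.sum_const, Finset.card_univ, Fintype.card_fin, nsmul_eq_mul]
    field_simp
  · refine integral_eq_zero_of_update _ i ((hgm i).const_mul _) fun D => ?_
    simp only [Function.update_self, integral_const_mul, hg0, mul_zero]
  · refine integral_eq_zero_of_update _ j ((hgm i).mul (hgm j)) fun D => ?_
    simp only [Function.update_self, Function.update_of_ne hij, integral_const_mul, hg0, mul_zero]

/-- Pythagoras for martingale differences, one time step per induction step. It is used twice: with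
`κ = 1` for the error, and with `κ = 0` for the occupancy estimate. -/
theorem integral_goodEst_sq_le (hr : BoundedRewards M H Rmax σ) (hw : BoundedWeights π μ H)
    (hn : 1 ≤ n) (κ y : ℝ) (W : ℕ → S → ℝ) (T : Fin (H + 1))
    (hW : ∀ t : Fin H, t.castSucc < T → ∀ s,
      W t s = ∫ x, (κ * x.2 + W (t + 1) x.1.2) ∂(step M π t s)) :
    ∫ D, goodEst M π μ κ y W T D ^ 2 ∂(dataLaw M μ H n) ≤
      (∑ s, stateDist M μ 0 s * W 0 s - y) ^ 2 + (∑ s, stateDist M μ 0 s * W 0 s ^ 2) / n +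
        ∑ t : Fin H, if t.castSucc < T then
          ∑ s, meanSqDiv M π μ n t s * returnSq M π μ κ (W (t + 1)) t s else 0 := by
  induction T using Fin.induction with
  | zero => simpa using integral_goodEst_zero_sq_le hn κ y W
  | succ t ih =>
    have ih' := ih fun u hu => hW u (hu.trans t.castSucc_lt_succ)
    have hWt := hW t t.castSucc_lt_succ
    obtain ⟨B, hB⟩ := exists_abs_incrWeight_le M hw n t
    simp_rw [goodEst_succ]
    rw [sum_ite_lt_succ]
    have h1 := integral_sq_add_increment M μ t (measurable_goodEst (M := M) κ y W t.castSucc)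
      (memLp_goodEst hr hw κ y W t.castSucc) (adapted_goodEst κ y W t.castSucc)
      (measurable_incrWeight M π μ t) hB (adapted_incrWeight M π μ t)
      (measurable_centered π μ κ W t) (memLp_centered_rollout hr hw κ W t)
      (integrable_centered_sq hr hw κ W t.isLt)
      (fun s => integral_centered hr hw κ W t.isLt s (hWt s))
    simp only [increment]
    rw [h1, ← add_assoc]
    refine add_le_add ih' ?_
    simp_rw [sum_incrWeight_sq_mul M π μ t _
      (fun s => ∫ x, centered π μ κ W t s x ^ 2 ∂(step M μ t s))]
    rw [integral_finsetSum _ fun s _ => (integrable_goodDist_sq_div M hw n t s).mul_const _]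
    refine Finset.sum_le_sum fun s _ => ?_
    rw [integral_mul_const]
    exact mul_le_mul_of_nonneg_left (integral_centered_sq_le hr hw κ W t.isLt s (hWt s))
      (meanSqDiv_nonneg M π μ n t s)

end Fixed

end SecondMoment

/-! ### The state distribution estimate -/

section Occupancy

variable {S A : Type*} [Fintype S] [MeasurableSpace S] [DiscreteMeasurableSpace S]
  [MeasurableSpace A] {ν : Measure A} {H n : ℕ}

/-- The expected `κ`-scaled rewards, collected with the policy `p` from `k` steps before time `T`
until time `T`, plus the final reward `f`. -/
def backwardValue (M : EpisodicMDP S A) (p : Policy S A ν) (κ : ℝ) (T : ℕ) (f : S → ℝ) :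
    ℕ → S → ℝ
  | 0 => f
  | k + 1 => fun s =>
    ∫ x, (κ * x.2 + backwardValue M p κ T f k x.1.2) ∂(step M p (T - (k + 1)) s)

theorem exists_bellman (M : EpisodicMDP S A) (p : Policy S A ν) (κ : ℝ) (T : ℕ) (f : S → ℝ) :
    ∃ W : ℕ → S → ℝ, W T = f ∧
      ∀ t < T, ∀ s, W t s = ∫ x, (κ * x.2 + W (t + 1) x.1.2) ∂(step M p t s) := by
  refine ⟨fun t => backwardValue M p κ T f (T - t), by simp [backwardValue], fun t ht s => ?_⟩
  obtain ⟨k, rfl⟩ := Nat.exists_eq_add_of_lt ht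
  have h1 : t + k + 1 - t = k + 1 := by omega
  have h2 : t + k + 1 - (t + 1) = k := by omega
  have h3 : t + k + 1 - (k + 1) = t := by omega
  simp only [h1, h2, backwardValue, h3]

theorem integral_return_eq {M : EpisodicMDP S A} {Rmax σ : ℝ} (hr : BoundedRewards M H Rmax σ)
    (p : Policy S A ν) (κ : ℝ) (f : S → ℝ) {t : ℕ} (ht : t < H) (s : S) :
    ∫ x, (κ * x.2 + f x.1.2) ∂(step M p t s) =
      κ * ∫ x, x.2 ∂(step M p t s) + ∑ s', transProb M p t s s' * f s' := by
  obtain ⟨B, hB⟩ := exists_abs_le f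
  have hf : Measurable f := Measurable.of_discrete
  have h1 : Integrable (fun x : (A × S) × ℝ => x.2) (step M p t s) :=
    (hr.memLp_step p ht s).integrable (by norm_num)
  rw [integral_add (h1.const_mul κ) (Integrable.of_bound
    (by fun_prop : Measurable fun x : (A × S) × ℝ => f x.1.2).aestronglyMeasurable B
    (ae_of_all _ fun x => hB _)), integral_const_mul, integral_transProb]

theorem sum_stateDist_mul_eq {M : EpisodicMDP S A} {Rmax σ : ℝ} (hr : BoundedRewards M H Rmax σ)
    (p : Policy S A ν) (κ : ℝ) {W : ℕ → S → ℝ} {t : ℕ} (ht : t < H)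
    (hW : ∀ s, W t s = ∫ x, (κ * x.2 + W (t + 1) x.1.2) ∂(step M p t s)) :
    ∑ s, stateDist M p t s * W t s =
      κ * ∑ s, stateDist M p t s * ∫ x, x.2 ∂(step M p t s) +
        ∑ s, stateDist M p (t + 1) s * W (t + 1) s := by
  simp_rw [hW, integral_return_eq hr p κ _ ht, stateDist_succ, Finset.sum_mul]
  rw [Finset.sum_comm (γ := S), Finset.mul_sum, ← Finset.sum_add_distrib]
  refine Finset.sum_congr rfl fun s _ => ?_
  rw [mul_add, Finset.mul_sum]
  congr 1
  · ring
  · exact Finset.sum_congr rfl fun s' _ => by ring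

theorem minMaxDist_le (M : EpisodicMDP S A) (π μ : Policy S A ν) {t : ℕ} (ht : t < H) {s : S}
    (hs : 0 < stateDist M π t s) :
    minMaxDist M π μ H ≤ max (stateDist M π t s) (stateDist M μ t s) :=
  ciInf_le (f := fun x : Reached M π H => max (stateDist M π x.1.1 x.1.2)
    (stateDist M μ x.1.1 x.1.2)) (Set.finite_range _).bddBelow ⟨(⟨t, ht⟩, s), hs⟩

theorem minDist_le (M : EpisodicMDP S A) (π μ : Policy S A ν) {t : ℕ} (ht : t < H) {s : S}
    (hs : 0 < stateDist M π t s) : minDist M π μ H ≤ stateDist M μ t s :=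
  ciInf_le (f := fun x : Reached M π H => stateDist M μ x.1.1 x.1.2)
    (Set.finite_range _).bddBelow ⟨(⟨t, ht⟩, s), hs⟩

theorem minMaxDist_pos (M : EpisodicMDP S A) (π μ : Policy S A ν) {t : ℕ} (ht : t < H) {s : S}
    (hs : 0 < stateDist M π t s) : 0 < minMaxDist M π μ H := by
  have : Nonempty (Reached M π H) := ⟨⟨(⟨t, ht⟩, s), hs⟩⟩
  obtain ⟨x, hx⟩ := exists_eq_ciInf_of_finite (f := fun x : Reached M π H =>
    max (stateDist M π x.1.1 x.1.2) (stateDist M μ x.1.1 x.1.2))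
  rw [minMaxDist, ← hx]
  exact x.2.trans_le (le_max_left _ _)

theorem minDist_pos {M : EpisodicMDP S A} {π μ : Policy S A ν} (hw : BoundedWeights π μ H) {t : ℕ}
    (ht : t < H) {s : S} (hs : 0 < stateDist M π t s) : 0 < minDist M π μ H := by
  have : Nonempty (Reached M π H) := ⟨⟨(⟨t, ht⟩, s), hs⟩⟩
  obtain ⟨x, hx⟩ := exists_eq_ciInf_of_finite (f := fun x : Reached M π H =>
    stateDist M μ x.1.1 x.1.2)
  rw [minDist, ← hx]
  exact stateDist_pos hw x.1.1.isLt.le x.2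

/-- The instance `t = H` of the sample size condition is the strongest one. It exists only for `H ≥
2`, so time `0` must be treated without it. -/
theorem SampleSize.le_max {M : EpisodicMDP S A} {π μ : Policy S A ν}
    (hs : SampleSize M π μ H n) (hH : 2 ≤ H) {t : ℕ} (ht : t < H) {s : S}
    (h0 : 0 < stateDist M π t s) : 4 * H * tauA π μ H * tauS M π μ H ≤
      n * max (stateDist M π t s) (stateDist M μ t s) := by
  have h1 := (le_max_left _ _).trans_lt (hs H hH le_rfl)
  rw [div_lt_iff₀ (minMaxDist_pos M π μ ht h0)] at h1
  exact h1.le.trans (mul_le_mul_of_nonneg_left (minMaxDist_le M π μ ht h0) n.cast_nonneg)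

theorem SampleSize.log_le {M : EpisodicMDP S A} {π μ : Policy S A ν}
    (hs : SampleSize M π μ H n) (hw : BoundedWeights π μ H) (hH : 2 ≤ H) {t : ℕ} (ht : t < H)
    {s : S} (h0 : 0 < stateDist M π t s) : 16 * Real.log n ≤ n * stateDist M μ t s := by
  have h1 := (le_max_right _ _).trans_lt (hs H hH le_rfl)
  rw [div_lt_iff₀ (minDist_pos hw ht h0)] at h1
  exact h1.le.trans (mul_le_mul_of_nonneg_left (minDist_le M π μ ht h0) n.cast_nonneg)

/-- On the good event `d̂_t(s)` is the terminal value of the decomposition for the indicator of `s`.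
The three terms are its squared mean, the sampling noise of the initial states, and one noise term
for each earlier time. -/
theorem integral_goodDist_sq_le {M : EpisodicMDP S A} {π μ : Policy S A ν} {Rmax σ : ℝ}
    (hr : BoundedRewards M H Rmax σ) (hw : BoundedWeights π μ H) (hn : 1 ≤ n) (t : Fin H) {K : ℝ}
    (hK : ∀ u < t, ∀ s, meanSqDiv M π μ n u s ≤ K * stateDist M π u s) (s : S) :
    ∫ D, goodDist M π μ t s D ^ 2 ∂(dataLaw M μ H n) ≤
      stateDist M π t s ^ 2 + stateDist M π t s / n +
        t * (tauA π μ H * K * stateDist M π t s) := by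
  classical
  obtain ⟨W, hWt, hW⟩ := exists_bellman M π 0 t fun s' => if s' = s then 1 else 0
  have hW' : ∀ u < (t : ℕ), ∀ s, W u s = ∑ s', transProb M π u s s' * W (u + 1) s' :=
    fun u hu s => by
      rw [hW u hu, integral_return_eq hr π 0 _ (hu.trans t.isLt)]; simp
  have hW01 : ∀ k u, u + k = (t : ℕ) → ∀ s, W u s ∈ Set.Icc (0 : ℝ) 1 := by
    intro k
    induction k with
    | zero =>
      rintro u hu s'
      rw [add_zero] at hu
      rw [hu, hWt]
      dsimp only
      split_ifs <;> simp
    | succ k ih =>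
      intro u hu s'
      have h := ih (u + 1) (by omega)
      rw [hW' u (by omega) s']
      refine ⟨Finset.sum_nonneg fun s'' _ => mul_nonneg (transProb_nonneg _ _ _ _ _) (h s'').1, ?_⟩
      rw [← sum_transProb M π u s']
      exact Finset.sum_le_sum fun s'' _ =>
        mul_le_of_le_one_right (transProb_nonneg _ _ _ _ _) (h s'').2
  -- Averaging the reaching probabilities over `d_u^π` gives the same number at every time `u`.
  -- Hence each noise term is proportional to `d_t^π(s)`, without a sum over states.
  have hsum : ∀ k u, u + k = (t : ℕ) → ∑ s', stateDist M π u s' * W u s' = stateDist M π t s := by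
    intro k
    induction k with
    | zero =>
      rintro u hu
      rw [add_zero] at hu
      rw [hu, hWt]
      simp
    | succ k ih =>
      intro u hu
      rw [sum_stateDist_mul_eq hr π 0 (by omega) (hW u (by omega)), ih (u + 1) (by omega)]
      ring
  have hsumt : ∀ u : Fin H, u ≤ t → ∑ s', stateDist M π u s' * W u s' = stateDist M π t s :=
    fun u hu => hsum (t - u) u (by have : (u : ℕ) ≤ t := hu; omega)
  have h1 : ∀ D : Fin n → Traj S A H,
      goodDist M π μ t s D ^ 2 ≤ goodEst M π μ 0 0 W t.castSucc D ^ 2 := fun D => by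
    by_cases hD : Good M π μ t D
    · refine le_of_eq ?_
      congr 1
      have h2 := partialEst_eq_add_sum 0 W t.castSucc (M := M) (π := π) (μ := μ) (D := D)
        fun u hu => hD.mono (Fin.castSucc_lt_castSucc_iff.1 hu).le
      simp only [partialEst, zero_mul, zero_add, Fin.val_castSucc, Fin.val_zero, hWt, mul_ite,
        mul_one, mul_zero, Finset.sum_ite_eq', Finset.mem_univ, if_true] at h2
      rw [goodDist, if_pos hD, goodEst, sub_zero, h2]
    · rw [goodDist, if_neg hD]
      simpa using sq_nonneg _
  have h2 := integral_goodEst_sq_le hr hw hn 0 0 W t.castSucc fun u hu s => hW u hu s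
  have hzero : ∑ s', stateDist M μ 0 s' * W 0 s' = stateDist M π t s := hsum t 0 (by simp)
  have hsq : ∑ s', stateDist M μ 0 s' * W 0 s' ^ 2 ≤ stateDist M π t s := by
    rw [← hzero]
    refine Finset.sum_le_sum fun s' _ => mul_le_mul_of_nonneg_left ?_ (stateDist_nonneg _ _ _ _)
    have := hW01 t 0 (by simp) s'
    nlinarith [this.1, this.2]
  refine (integral_mono (integrable_goodDist_sq M hw n t s)
    (memLp_goodEst hr hw 0 0 W t.castSucc).integrable_sq h1).trans (h2.trans ?_)
  rw [hzero, sub_zero]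
  gcongr
  have h3 : ∀ u : Fin H, (if u.castSucc < t.castSucc then ∑ s', meanSqDiv M π μ n u s' *
      returnSq M π μ 0 (W (u + 1)) u s' else 0) ≤
      if u < t then tauA π μ H * K * stateDist M π t s else 0 := fun u => by
    simp only [Fin.castSucc_lt_castSucc_iff]
    split_ifs with hu
    · rw [← hsumt u hu.le, Finset.mul_sum]
      refine Finset.sum_le_sum fun s' _ => ?_
      have h4 := returnSq_zero_le (M := M) hw u.isLt s' (f := W (u + 1))
        (hW01 (t - (u + 1)) (u + 1) (by have : (u : ℕ) < t := hu; omega))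
      have h5 : ∫ x, W (u + 1) x.1.2 ∂(step M π u s') = W u s' := by
        rw [hW u hu s']; simp
      rw [h5] at h4
      calc _ ≤ (K * stateDist M π u s') * (tauA π μ H * W u s') :=
            mul_le_mul (hK u hu s') h4 (returnSq_nonneg _ _ _ _ _ _ _)
              ((meanSqDiv_nonneg M π μ n u s').trans (hK u hu s'))
        _ = _ := by ring
    · exact le_rfl
  refine (Finset.sum_le_sum fun u _ => h3 u).trans (le_of_eq ?_)
  rw [← Finset.sum_filter, Finset.sum_const, nsmul_eq_mul]
  congr 2
  rw [Finset.filter_gt_eq_Iio, Fin.card_Iio]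

theorem meanSqDiv_le_of_pos {M : EpisodicMDP S A} {π μ : Policy S A ν}
    (hw : BoundedWeights π μ H) (hn : 1 ≤ n) (t : Fin H) (ht : (t : ℕ) ≠ 0) (s : S)
    (hs : 0 < stateDist M μ t s) :
    meanSqDiv M π μ n t s ≤
      2 / (n * stateDist M μ t s) * ∫ D, goodDist M π μ t s D ^ 2 ∂(dataLaw M μ H n) := by
  have hn0 : (0 : ℝ) < n := by positivity
  rw [meanSqDiv, ← integral_const_mul]
  refine integral_mono (integrable_goodDist_sq_div M hw n t s)
    ((integrable_goodDist_sq M hw n t s).const_mul _) fun D => ?_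
  simp only [goodDist]
  split_ifs with hD
  · rcases hD t le_rfl s with h | ⟨-, h | h⟩
    · simp [h]
    · exact absurd h ht
    · have h1 : 0 < n * stateDist M μ t s / 2 := by positivity
      rw [div_eq_mul_inv, mul_comm]
      refine mul_le_mul_of_nonneg_right ?_ (sq_nonneg _)
      rw [inv_le_comm₀ (h1.trans_le h) (by positivity), inv_div]
      exact h
  · simp

/-- At time `0` the estimate is `n_{0,s} / n`, so `d̂² / n_{0,s}` is at most `n_{0,s} / n²` and no
lower bound on the count is required. -/
theorem meanSqDiv_zero_le {M : EpisodicMDP S A} {π μ : Policy S A ν}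
    (hw : BoundedWeights π μ H) (hn : 1 ≤ n) (t : Fin H) (ht : (t : ℕ) = 0) (s : S) :
    meanSqDiv M π μ n t s ≤ stateDist M π t s / n := by
  classical
  have ht' : t.castSucc = 0 := Fin.ext ht
  have hn0 : (0 : ℝ) < n := by positivity
  let f : S → ℝ := fun s' => if s' = s then 1 else 0
  have hf : Measurable f := Measurable.of_discrete
  have hi : ∀ i : Fin n, Integrable (fun D : Fin n → Traj S A H => f ((D i).1 0))
      (dataLaw M μ H n) := fun i => Integrable.of_bound
        (by fun_prop : Measurable _).aestronglyMeasurable 1 (ae_of_all _ fun D => by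
          simp only [f]; split_ifs <;> simp)
  have h1 : ∀ D : Fin n → Traj S A H, goodDist M π μ t s D ^ 2 / visits D t.castSucc s ≤
      (1 / (n : ℝ)) * ∑ i, (1 / (n : ℝ)) * f ((D i).1 0) := fun D => by
    have h2 : ∑ i, (1 / (n : ℝ)) * f ((D i).1 0) = visits D 0 s / n := by
      rw [← sum_distHat_zero_mul (π := π) (μ := μ)]
      simp [f, distHat_zero]
    rw [h2, ht', goodDist, ht', distHat_zero]
    have h3 := visits_nonneg D 0 s
    split_ifs
    · refine le_of_eq ?_
      rcases eq_or_ne (visits D 0 s) 0 with h | h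
      · simp [h]
      · field_simp
    · rw [zero_pow two_ne_zero, zero_div]
      positivity
  refine (integral_mono (integrable_goodDist_sq_div M hw n t s)
    ((integrable_finsetSum _ fun i _ => (hi i).const_mul _).const_mul _) h1).trans (le_of_eq ?_)
  rw [integral_const_mul, integral_finsetSum _ fun i _ => (hi i).const_mul _]
  have h4 : ∀ i : Fin n, ∫ D, (1 / (n : ℝ)) * f ((D i).1 0) ∂(dataLaw M μ H n) =
      (1 / (n : ℝ)) * stateDist M μ 0 s := fun i => by
    rw [integral_const_mul]
    congr 1
    have h5 := measurePreserving_episode (H := H) M μ i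
    have h6 := integral_map (μ := dataLaw M μ H n) h5.measurable.aemeasurable
      (f := fun τ : Traj S A H => f (τ.1 0)) (by fun_prop : Measurable _).aestronglyMeasurable
    rw [h5.map_eq] at h6
    rw [← h6, integral_state M μ 0 f]
    simp [f]
  simp only [h4, Finset.sum_const, Finset.card_univ, Fintype.card_fin, nsmul_eq_mul, ht]
  rw [stateDist_zero_eq M π μ]
  field_simp

theorem sq_div_le (M : EpisodicMDP S A) (π μ : Policy S A ν) {t : ℕ} (ht : t < H) (s : S) :
    stateDist M π t s ^ 2 / stateDist M μ t s ≤ tauS M π μ H * stateDist M π t s := by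
  rw [sq, mul_div_assoc, mul_comm]
  exact mul_le_mul_of_nonneg_right (div_le_tauS M π μ ht s) (stateDist_nonneg _ _ _ _)

theorem add_max_le {M : EpisodicMDP S A} {π μ : Policy S A ν} (hw : BoundedWeights π μ H) {t : ℕ}
    (ht : t < H) (s : S) : stateDist M π t s ^ 2 / stateDist M μ t s +
      max (stateDist M π t s ^ 2 / stateDist M μ t s) (stateDist M π t s) ≤
        2 * (tauS M π μ H * stateDist M π t s) := by
  have h1 := sq_div_le M π μ ht s
  have h2 : stateDist M π t s ≤ tauS M π μ H * stateDist M π t s :=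
    le_mul_of_one_le_left (stateDist_nonneg _ _ _ _) (one_le_tauS hw (Nat.zero_lt_of_lt ht))
  linarith [max_le h1 h2]

/-- Strong induction on time. The bound is at most `4 τ_s / n` times `d_t^π(s)`, and this weaker
form suffices as the hypothesis for later times; the sharp form is kept for the coverage bound. -/
theorem meanSqDiv_le {M : EpisodicMDP S A} {π μ : Policy S A ν} {Rmax σ : ℝ}
    (hr : BoundedRewards M H Rmax σ) (hw : BoundedWeights π μ H) (hs : SampleSize M π μ H n)
    (hn : 1 ≤ n) (t : Fin H) (s : S) :
    meanSqDiv M π μ n t s ≤ 2 / n * (stateDist M π t s ^ 2 / stateDist M μ t s +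
      max (stateDist M π t s ^ 2 / stateDist M μ t s) (stateDist M π t s)) := by
  have hn0 : (0 : ℝ) < n := by positivity
  have hH : 0 < H := t.pos
  have := M.nonempty_state
  have hA := one_le_tauA hw hH
  have hS := one_le_tauS (M := M) hw hH
  induction t using WellFoundedLT.induction generalizing s with
  | ind t ih =>
    set p := stateDist M π t s with hp
    set q := stateDist M μ t s with hq
    have hp0 : 0 ≤ p := stateDist_nonneg _ _ _ _
    have hq0 : 0 ≤ q := stateDist_nonneg _ _ _ _
    rcases eq_or_ne (t : ℕ) 0 with ht | ht
    · refine (meanSqDiv_zero_le hw hn t ht s).trans ?_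
      rw [← hp, div_eq_mul_inv, div_mul_eq_mul_div, div_eq_mul_inv]
      refine mul_le_mul_of_nonneg_right ?_ (by positivity)
      have : 0 ≤ p ^ 2 / q := by positivity
      linarith [le_max_right (p ^ 2 / q) p]
    · have hK : ∀ u < t, ∀ s, meanSqDiv M π μ n u s ≤ (4 * tauS M π μ H / n) * stateDist M π u s :=
        fun u hu s => (ih u hu s).trans (by
          calc _ ≤ 2 / n * (2 * (tauS M π μ H * stateDist M π u s)) :=
                mul_le_mul_of_nonneg_left (add_max_le hw u.isLt s) (by positivity)
            _ = _ := by ring)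
      have hm := integral_goodDist_sq_le hr hw hn t hK s
      rw [← hp] at hm
      -- If `p = 0` then `q` may vanish too; but then the second moment bound is already zero.
      rcases hp0.eq_or_lt with h0 | h0
      · refine (integral_mono (integrable_goodDist_sq_div M hw n t s)
          (integrable_goodDist_sq M hw n t s) fun D => sq_div_visits_le D _ s _).trans (hm.trans ?_)
        simp [← h0]
      · have hqp : 0 < q := stateDist_pos hw t.isLt.le h0
        have htH : (t : ℝ) + 1 ≤ H := by exact_mod_cast t.isLt
        have hsz := hs.le_max (by have := t.isLt; omega) t.isLt h0
        rw [← hp, ← hq] at hsz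
        refine (meanSqDiv_le_of_pos hw hn t ht s hqp).trans ?_
        rw [← hq]
        have hm2 : ∫ D, goodDist M π μ t s D ^ 2 ∂(dataLaw M μ H n) ≤ p ^ 2 + p * max p q := by
          refine hm.trans ?_
          rw [add_assoc]
          refine add_le_add le_rfl ?_
          have h1 : p / n + t * (tauA π μ H * (4 * tauS M π μ H / n) * p) =
              p / n * (1 + 4 * t * (tauA π μ H * tauS M π μ H)) := by ring
          have h2 : 1 ≤ tauA π μ H * tauS M π μ H := one_le_mul_of_one_le_of_one_le hA hS
          -- As `t + 1 ≤ H`, the spare `4 τ_a τ_s ≥ 1` in `4 H τ_a τ_s` pays for the initial noise.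
          have h3 : 1 + 4 * t * (tauA π μ H * tauS M π μ H) ≤ n * max p q := by
            refine le_trans ?_ hsz
            nlinarith
          rw [h1]
          calc _ ≤ p / n * (n * max p q) := mul_le_mul_of_nonneg_left h3 (by positivity)
            _ = _ := by field_simp
        refine (mul_le_mul_of_nonneg_left hm2 (by positivity)).trans (le_of_eq ?_)
        have h4 : max (p ^ 2 / q) p = p * max p q / q := by
          rw [mul_max_of_nonneg _ _ hp0, ← max_div_div_right hqp.le, ← sq,
            mul_div_cancel_right₀ _ hqp.ne']
        rw [h4]
        field_simp

end Occupancy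

/-! ### The probability of the good event -/

section GoodEvent

variable {S A : Type*} [Fintype S] [MeasurableSpace S] [DiscreteMeasurableSpace S]
  [MeasurableSpace A] {ν : Measure A} {H n : ℕ}

theorem rollout_real_state (M : EpisodicMDP S A) (p : Policy S A ν) (t : Fin (H + 1)) (s : S) :
    (rollout M p H).real {τ | τ.1 t = s} = stateDist M p t s := by
  have ht : (t : ℕ) ≤ H := Nat.lt_succ_iff.1 t.isLt
  have hm : MeasurableSet {τ : Traj S A t | τ.1 (Fin.last t) = s} :=
    (by fun_prop : Measurable fun τ : Traj S A t => τ.1 (Fin.last t)) (measurableSet_singleton s)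
  rw [stateDist, ← map_truncate M p ht, map_measureReal_apply (measurable_truncate ht) hm]
  rfl

/-- A move from a state reached by `π` into one that is not has probability zero under `π`. That
probability is a `μ`-integral of the nonnegative weight, which therefore vanishes almost surely on
such moves. -/
theorem ae_weight_eq_zero {M : EpisodicMDP S A} {π μ : Policy S A ν} (hw : BoundedWeights π μ H)
    (t : Fin H) (s s' : S) (hs : stateDist M π t s ≠ 0) (hs' : stateDist M π (t + 1) s' = 0) :
    ∀ᵐ τ ∂(rollout M μ H),
      τ.1 t.castSucc = s → τ.1 t.succ = s' → weight π μ t s (τ.2 t).1 = 0 := by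
  have hm' : MeasurableSet ({x | x.1.2 = s'} : Set ((A × S) × ℝ)) :=
    (measurable_snd.comp measurable_fst) (measurableSet_singleton s')
  have hwm := measurable_weight_step π μ t s
  have h0 : transProb M π t s s' = 0 := by
    rw [stateDist_succ, Finset.sum_eq_zero_iff_of_nonneg fun s _ =>
      mul_nonneg (stateDist_nonneg _ _ _ _) (transProb_nonneg _ _ _ _ _)] at hs'
    exact (mul_eq_zero.1 (hs' s (Finset.mem_univ s))).resolve_left hs
  have hnn : ∀ x : (A × S) × ℝ, 0 ≤ weight π μ t s x.1.1 *
      ({x | x.1.2 = s'} : Set ((A × S) × ℝ)).indicator 1 x := fun x =>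
    mul_nonneg (weight_nonneg _ _ _ _ _) (Set.indicator_nonneg (fun _ _ => zero_le_one) _)
  rw [transProb_eq M hw t.isLt, integral_eq_zero_iff_of_nonneg hnn] at h0
  · have h1 : ∀ᵐ x ∂(step M μ t s), x.1.2 = s' → weight π μ t s x.1.1 = 0 := by
      filter_upwards [h0] with x hx hx'
      simpa [hx'] using hx
    have hset : MeasurableSet {y : Traj S A t × ((A × S) × ℝ) |
        y.1.1 (Fin.last t) = s → y.2.1.2 = s' → weight π μ t s y.2.1.1 = 0} := by
      have hl : Measurable fun y : Traj S A t × ((A × S) × ℝ) => y.1.1 (Fin.last t) := by fun_prop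
      have hr : Measurable fun y : Traj S A t × ((A × S) × ℝ) => y.2.1.2 := by fun_prop
      have hv : Measurable fun y : Traj S A t × ((A × S) × ℝ) => weight π μ t s y.2.1.1 :=
        hwm.comp measurable_snd
      exact (hl (measurableSet_singleton s)).imp ((hr (measurableSet_singleton s')).imp
        (hv (measurableSet_singleton 0)))
    have h2 : ∀ᵐ y ∂(rollout M μ t ⊗ₘ nextStep M μ t),
        y.1.1 (Fin.last t) = s → y.2.1.2 = s' → weight π μ t s y.2.1.1 = 0 := by
      refine Measure.ae_compProd_of_ae_ae hset (ae_of_all _ fun τ => ?_)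
      by_cases h : τ.1 (Fin.last t) = s
      · have : nextStep M μ t τ = step M μ t s := by rw [Kernel.comap_apply, h]
        rw [this]
        filter_upwards [h1] with x hx _ using hx
      · exact ae_of_all _ fun x hx => absurd hx h
    exact (measurePreserving_truncate_stepAt M μ t).quasiMeasurePreserving.ae h2
  · refine Integrable.of_bound (hwm.mul (measurable_one.indicator hm')).aestronglyMeasurable
      (tauA π μ H) (ae_of_all _ fun x => ?_)
    rw [Real.norm_of_nonneg (hnn x)]
    have h1 := weight_le_tauA hw t.isLt s x.1.1
    have h2 := weight_nonneg π μ t s x.1.1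
    by_cases hx : x.1.2 = s' <;> simp [hx] <;> linarith

/-- The sample size condition says nothing about states that `π` never reaches, so their counts
cannot be controlled. They do no harm, since the estimate gives them no mass. -/
theorem ae_distHat_eq_zero {M : EpisodicMDP S A} {π μ : Policy S A ν} (hw : BoundedWeights π μ H) :
    ∀ᵐ D ∂(dataLaw M μ H n), ∀ (t : Fin (H + 1)) (s : S), stateDist M π t s = 0 →
      distHat π μ D t s = 0 := by
  have h1 : ∀ᵐ D ∂(dataLaw M μ H n), ∀ (i : Fin n) (s : S), stateDist M π 0 s = 0 →
      (D i).1 0 ≠ s := by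
    rw [ae_all_iff]; intro i
    rw [ae_all_iff]; intro s
    by_cases hs : stateDist M π 0 s = 0
    · have h2 : ∀ᵐ τ ∂(rollout M μ H), τ.1 0 ≠ s := by
        rw [ae_iff]
        simp only [ne_eq, not_not]
        rw [← measureReal_eq_zero_iff, rollout_real_state M μ (0 : Fin (H + 1)) s]
        exact hs
      filter_upwards [(measurePreserving_episode M μ i).quasiMeasurePreserving.ae h2] with D hD _
        using hD
    · exact ae_of_all _ fun D h => absurd h hs
  have h2 : ∀ᵐ D ∂(dataLaw M μ H n), ∀ (i : Fin n) (t : Fin H) (s s' : S),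
      stateDist M π t s ≠ 0 → stateDist M π (t + 1) s' = 0 → (D i).1 t.castSucc = s →
        (D i).1 t.succ = s' → weight π μ t s ((D i).2 t).1 = 0 := by
    rw [ae_all_iff]; intro i
    rw [ae_all_iff]; intro t
    rw [ae_all_iff]; intro s
    rw [ae_all_iff]; intro s'
    by_cases hs : stateDist M π t s ≠ 0 ∧ stateDist M π (t + 1) s' = 0
    · filter_upwards [(measurePreserving_episode M μ i).quasiMeasurePreserving.ae
        (ae_weight_eq_zero hw t s s' hs.1 hs.2)] with D hD _ _ using hD
    · exact ae_of_all _ fun D h h' => absurd ⟨h, h'⟩ hs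
  filter_upwards [h1, h2] with D hD1 hD2 t
  induction t using Fin.induction with
  | zero =>
    intro s hs
    have : visits D 0 s = 0 := Finset.sum_eq_zero fun i _ => if_neg (hD1 i s hs)
    rw [distHat_zero, this, zero_div]
  | succ t ih =>
    intro s' hs'
    rw [distHat_succ]
    refine Finset.sum_eq_zero fun s _ => ?_
    by_cases hs : stateDist M π t s = 0
    · rw [ih s hs, mul_zero]
    · have : transHat π μ D t s s' = 0 := by
        unfold transHat
        refine mul_eq_zero_of_right _ (Finset.sum_eq_zero fun i _ => ?_)
        split_ifs with h
        · exact hD2 i t s s' hs hs' h.1 h.2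
        · rfl
      rw [this, zero_mul]

/-- Chernoff's method with the base-two exponential: with `N` the visit count, `2^(-N)` has mean `(1
- p / 2)^n ≤ exp(-n p / 2)`, and Markov's inequality is applied at the level `2^(-n p / 2)`. -/
theorem real_visits_lt_le (M : EpisodicMDP S A) (μ : Policy S A ν) (n : ℕ) (t : Fin (H + 1))
    (s : S) :
    (dataLaw M μ H n).real {D | visits D t s < n * stateDist M μ t s / 2} ≤
      Real.exp (-(n * stateDist M μ t s / 8)) := by
  classical
  set p := stateDist M μ t s with hp
  let f : S → ℝ := fun s' => Real.exp (-Real.log 2 * if s' = s then 1 else 0)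
  have hf : Measurable f := Measurable.of_discrete
  have hprod : ∀ D : Fin n → Traj S A H,
      ∏ i, f ((D i).1 t) = Real.exp (-Real.log 2 * visits D t s) := fun D => by
    rw [← Real.exp_sum, ← Finset.mul_sum, visits]
  have hint : ∫ D, ∏ i, f ((D i).1 t) ∂(dataLaw M μ H n) = (1 - p / 2) ^ n := by
    unfold dataLaw
    rw [integral_fintype_prod_eq_prod (ι := Fin n) (fun _ (τ : Traj S A H) => f (τ.1 t)),
      Finset.prod_const, Finset.card_univ, Fintype.card_fin, integral_state M μ t f]
    congr 1
    have h1 : ∀ s', stateDist M μ t s' * f s' =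
        stateDist M μ t s' - (if s' = s then stateDist M μ t s' / 2 else 0) := fun s' => by
      simp only [f]
      split_ifs
      · rw [mul_one, Real.exp_neg, Real.exp_log two_pos]; ring
      · simp
    simp_rw [h1]
    rw [Finset.sum_sub_distrib, sum_stateDist]
    simp [hp]
  have hle : (1 - p / 2) ^ n ≤ Real.exp (-(n * p / 2)) := by
    have h1 : 0 ≤ 1 - p / 2 := by linarith [stateDist_le_one M μ t s]
    refine (pow_le_pow_left₀ h1 (Real.one_sub_le_exp_neg (p / 2)) n).trans (le_of_eq ?_)
    rw [← Real.exp_nat_mul]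
    congr 1
    ring
  have hm : Measurable fun D : Fin n → Traj S A H => ∏ i, f ((D i).1 t) := by fun_prop
  have hi : Integrable (fun D : Fin n → Traj S A H => ∏ i, f ((D i).1 t)) (dataLaw M μ H n) := by
    refine Integrable.of_bound hm.aestronglyMeasurable 1 (ae_of_all _ fun D => ?_)
    rw [hprod, Real.norm_of_nonneg (Real.exp_nonneg _), Real.exp_le_one_iff]
    nlinarith [visits_nonneg D t s, Real.log_pos one_lt_two]
  have hmk := mul_meas_ge_le_integral_of_nonneg (μ := dataLaw M μ H n)
    (ae_of_all _ fun D => by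
      change (0 : ℝ) ≤ _
      rw [hprod]
      positivity) hi (Real.exp (-Real.log 2 * (n * p / 2)))
  rw [hint] at hmk
  have hsub : {D : Fin n → Traj S A H | visits D t s < n * p / 2} ⊆
      {D | Real.exp (-Real.log 2 * (n * p / 2)) ≤ ∏ i, f ((D i).1 t)} := fun D hD => by
    rw [Set.mem_ofPred_eq] at hD ⊢
    rw [hprod, Real.exp_le_exp]
    nlinarith [Real.log_pos one_lt_two]
  have h2 := (mul_le_mul_of_nonneg_left (measureReal_mono (μ := dataLaw M μ H n) hsub)
    (Real.exp_nonneg (-Real.log 2 * (n * p / 2)))).trans (hmk.trans hle)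
  rw [← le_div_iff₀' (Real.exp_pos _), ← Real.exp_sub] at h2
  refine h2.trans (Real.exp_le_exp.2 ?_)
  have h3 : 0 ≤ n * p := mul_nonneg n.cast_nonneg (stateDist_nonneg _ _ _ _)
  -- The exponent obtained is `-(1 - log 2) n p / 2`, and `(1 - log 2) / 2 > 1 / 8`.
  nlinarith [Real.log_two_lt_d9]

/-- The left side is at most `1 / n²`. Trading one factor `1 / n` for `d_t^μ(s)` makes the later
union bound sum to `1 / n` per time, independently of the number of states. -/
theorem SampleSize.exp_le {M : EpisodicMDP S A} {π μ : Policy S A ν} (hs : SampleSize M π μ H n)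
    (hw : BoundedWeights π μ H) (hn : 1 ≤ n) (hH : 2 ≤ H) {t : ℕ} (ht : t < H) {s : S}
    (h0 : 0 < stateDist M π t s) :
    Real.exp (-(n * stateDist M μ t s / 8)) ≤ stateDist M μ t s / n := by
  have hn0 : (0 : ℝ) < n := by positivity
  have := M.nonempty_state
  have hA := one_le_tauA hw (Nat.zero_lt_of_lt ht)
  have hS := one_le_tauS (M := M) hw (Nat.zero_lt_of_lt ht)
  have h1 := hs.le_max hH ht h0
  have h2 := hs.log_le hw hH ht h0
  have hH' : (2 : ℝ) ≤ H := by exact_mod_cast hH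
  have h3 : 1 ≤ tauA π μ H * tauS M π μ H := one_le_mul_of_one_le_of_one_le hA hS
  have h4 : n * max (stateDist M π t s) (stateDist M μ t s) ≤ n :=
    mul_le_of_le_one_right hn0.le (max_le (stateDist_le_one _ _ _ _) (stateDist_le_one _ _ _ _))
  -- `4 H τ_a τ_s ≥ 8` since `H ≥ 2`. Then `log n ≥ 7 / 8`, so `n d_t^μ(s) ≥ 14`, more than the `1`
  -- needed at the end.
  have h8 : (8 : ℝ) ≤ n := by
    refine le_trans ?_ (h1.trans h4)
    nlinarith
  have h5 : 7 / 8 ≤ Real.log n := by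
    refine le_trans ?_ (Real.one_sub_inv_le_log_of_pos hn0)
    have : (n : ℝ)⁻¹ ≤ 8⁻¹ := inv_anti₀ (by norm_num) h8
    linarith
  have h6 : Real.exp (-(n * stateDist M μ t s / 8)) ≤ Real.exp (-(2 * Real.log n)) :=
    Real.exp_le_exp.2 (by linarith)
  have h7 : Real.exp (-(2 * Real.log n)) = 1 / (n : ℝ) ^ 2 := by
    rw [Real.exp_neg, mul_comm, Real.exp_mul, Real.exp_log hn0]
    norm_cast
    simp
  rw [h7] at h6
  refine h6.trans ?_
  rw [div_le_div_iff₀ (by positivity) hn0]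
  nlinarith

theorem real_not_good_le {M : EpisodicMDP S A} {π μ : Policy S A ν} (hw : BoundedWeights π μ H)
    (hs : SampleSize M π μ H n) (hn : 1 ≤ n) :
    (dataLaw M μ H n).real {D | ¬∀ t : Fin H, Good M π μ t D} ≤ H / n := by
  classical
  have hn0 : (0 : ℝ) < n := by positivity
  -- Only positive times and states reached by `π` enter the union bound: time `0` is exempt in
  -- `Good`, and the other states are handled by the null set `N`.
  let E : Fin H × S → Set (Fin n → Traj S A H) := fun x =>
    if (x.1 : ℕ) ≠ 0 ∧ 0 < stateDist M π x.1 x.2 then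
      {D | visits D x.1.castSucc x.2 < n * stateDist M μ x.1 x.2 / 2} else ∅
  have hE : ∀ x, (dataLaw M μ H n).real (E x) ≤ stateDist M μ x.1 x.2 / n := fun x => by
    simp only [E]
    split_ifs with h
    · exact (real_visits_lt_le M μ n x.1.castSucc x.2).trans
        (hs.exp_le hw hn (by have := x.1.isLt; omega) x.1.isLt h.2)
    · rw [measureReal_empty]
      exact div_nonneg (stateDist_nonneg _ _ _ _) hn0.le
  let N : Set (Fin n → Traj S A H) := {D | ¬∀ (t : Fin (H + 1)) (s : S), stateDist M π t s = 0 →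
      distHat π μ D t s = 0}
  have hN : (dataLaw M μ H n).real N = 0 := by
    rw [measureReal_eq_zero_iff]
    exact ae_iff.1 (ae_distHat_eq_zero hw)
  have hsub : {D : Fin n → Traj S A H | ¬∀ t : Fin H, Good M π μ t D} ⊆ N ∪ ⋃ x, E x := by
    intro D hD
    by_contra hD'
    simp only [Set.mem_union, N, Set.mem_ofPred_eq, not_or, not_not, Set.mem_iUnion,
      not_exists] at hD'
    refine hD fun t u _ s => ?_
    by_cases h0 : distHat π μ D u.castSucc s = 0
    · exact Or.inl h0
    refine Or.inr ?_
    by_cases hu : (u : ℕ) = 0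
    · refine ⟨(visits_nonneg D _ s).lt_of_ne' fun h => h0 ?_, Or.inl hu⟩
      have hu' : u.castSucc = 0 := Fin.ext hu
      rw [hu'] at h ⊢
      rw [distHat_zero, h, zero_div]
    · have hpos : 0 < stateDist M π u s :=
        (stateDist_nonneg _ _ _ _).lt_of_ne' fun h => h0 (hD'.1 u.castSucc s h)
      have h1 := hD'.2 (u, s)
      simp only [E, if_pos (show (u : ℕ) ≠ 0 ∧ 0 < stateDist M π u s from ⟨hu, hpos⟩),
        Set.mem_ofPred_eq, not_lt] at h1
      have h2 : 0 < n * stateDist M μ u s / 2 := by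
        have := stateDist_pos hw u.isLt.le hpos
        positivity
      exact ⟨h2.trans_le h1, Or.inr h1⟩
  calc _ ≤ (dataLaw M μ H n).real (N ∪ ⋃ x, E x) := measureReal_mono hsub
    _ ≤ (dataLaw M μ H n).real N + (dataLaw M μ H n).real (⋃ x, E x) := measureReal_union_le _ _
    _ ≤ 0 + ∑ x, (dataLaw M μ H n).real (E x) := add_le_add hN.le (measureReal_iUnion_fintype_le _)
    _ ≤ ∑ x : Fin H × S, stateDist M μ x.1 x.2 / n := by
      rw [zero_add]; exact Finset.sum_le_sum fun x _ => hE x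
    _ = H / n := by
      rw [Fintype.sum_prod_type]
      simp_rw [← Finset.sum_div, sum_stateDist]
      simp [div_eq_mul_inv]

end GoodEvent

/-! ### The mean squared error -/

section Main

variable {S A : Type*} [Fintype S] [MeasurableSpace S] [DiscreteMeasurableSpace S]
  [MeasurableSpace A] {ν : Measure A} {H n : ℕ} {M : EpisodicMDP S A} {π μ : Policy S A ν}
  {Rmax σ : ℝ}

theorem value_eq_sum_initial (hr : BoundedRewards M H Rmax σ) (p : Policy S A ν) {W : ℕ → S → ℝ}
    (hWH : W H = fun _ => 0)
    (hW : ∀ t < H, ∀ s, W t s = ∫ x, (1 * x.2 + W (t + 1) x.1.2) ∂(step M p t s)) :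
    value M p H = ∑ s, stateDist M p 0 s * W 0 s := by
  have h : ∀ T : Fin (H + 1), ∑ s, stateDist M p 0 s * W 0 s =
      (∑ u : Fin H, if u.castSucc < T then ∑ s, stateDist M p u s * ∫ x, x.2 ∂(step M p u s)
        else 0) + ∑ s, stateDist M p T s * W T s := by
    intro T
    induction T using Fin.induction with
    | zero => simp
    | succ t ih =>
      rw [sum_ite_lt_succ, ih, Fin.val_castSucc, sum_stateDist_mul_eq hr p 1 t.isLt (hW t t.isLt),
        Fin.val_succ]
      ring
  rw [h (Fin.last H), value_eq_sum hr]
  simp [hWH, Fin.castSucc_lt_last]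

theorem measurable_misEstimator (π μ : Policy S A ν) :
    Measurable (misEstimator π μ : (Fin n → Traj S A H) → ℝ) :=
  Finset.measurable_sum _ fun t _ => Finset.measurable_sum _ fun s _ =>
    (measurable_distHat π μ _ s).mul (measurable_rewardHat π μ t s)

theorem measurable_sqError (M : EpisodicMDP S A) (π μ : Policy S A ν) (H n : ℕ) (Rmax : ℝ) :
    Measurable (sqError M π μ H n Rmax) :=
  ((measurable_const.max (measurable_const.min (measurable_misEstimator π μ))).sub_const _).pow_const
    2

theorem abs_clip_sub_le {b v x : ℝ} (hv : v ∈ Set.Icc 0 b) : |max 0 (min b x) - v| ≤ |x - v| := by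
  obtain ⟨h0, h1⟩ := hv
  rw [abs_le]
  constructor
  · rcases le_total 0 (x - v) with h | h
    · have : v ≤ max 0 (min b x) := le_max_of_le_right (le_min h1 (by linarith))
      linarith [abs_nonneg (x - v)]
    · rw [abs_of_nonpos h]
      have : x ≤ max 0 (min b x) := le_max_of_le_right (le_min (by linarith) le_rfl)
      linarith
  · rcases le_total 0 (x - v) with h | h
    · rw [abs_of_nonneg h]
      have : max 0 (min b x) ≤ x := max_le (by linarith) (min_le_right _ _)
      linarith
    · have : max 0 (min b x) ≤ v := max_le h0 ((min_le_right _ _).trans (by linarith))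
      linarith [abs_nonneg (x - v)]

theorem sqError_le_sq (hr : BoundedRewards M H Rmax σ) (D : Fin n → Traj S A H) :
    sqError M π μ H n Rmax D ≤ (misEstimator π μ D - value M π H) ^ 2 :=
  sq_le_sq.2 (abs_clip_sub_le (value_mem_Icc hr π))

theorem sqError_le (hr : BoundedRewards M H Rmax σ) (D : Fin n → Traj S A H) :
    sqError M π μ H n Rmax D ≤ (H * Rmax) ^ 2 := by
  obtain ⟨h0, h1⟩ := value_mem_Icc hr π
  refine sq_le_sq' ?_ ?_
  · have : 0 ≤ clippedEstimator π μ Rmax D := le_max_left _ _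
    linarith
  · have : clippedEstimator π μ Rmax D ≤ H * Rmax := max_le (h0.trans h1) (min_le_left _ _)
    linarith

theorem integrable_sqError (hr : BoundedRewards M H Rmax σ) :
    Integrable (sqError M π μ H n Rmax) (dataLaw M μ H n) :=
  Integrable.of_bound (measurable_sqError M π μ H n Rmax).aestronglyMeasurable ((H * Rmax) ^ 2)
    (ae_of_all _ fun D => by
      rw [Real.norm_of_nonneg (show 0 ≤ sqError M π μ H n Rmax D from sq_nonneg _)]
      exact sqError_le hr D)

/-- The three terms are the initial variance, the martingale increments, and the clipped error on
the bad event. -/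
theorem mse_le (hr : BoundedRewards M H Rmax σ) (hw : BoundedWeights π μ H)
    (hs : SampleSize M π μ H n) (hn : 1 ≤ n) :
    mse M π μ H n Rmax ≤ (H * Rmax) ^ 2 / n +
      (∑ t : Fin H, ∑ s, meanSqDiv M π μ n t s * meanWeight π μ t s) *
        (σ ^ 2 + (H * Rmax) ^ 2) + H / n * (H * Rmax) ^ 2 := by
  classical
  obtain ⟨s₀⟩ := M.nonempty_state
  obtain ⟨a₀⟩ := π.nonempty_action s₀
  have hn0 : (0 : ℝ) < n := by positivity
  obtain ⟨W, hWH, hW⟩ := exists_bellman M π 1 H fun _ => (0 : ℝ)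
  have hval := value_eq_sum_initial hr π hWH hW
  have hW01 : ∀ k u, u + k = H → ∀ s, W u s ∈ Set.Icc (0 : ℝ) (k * Rmax) := by
    intro k
    induction k with
    | zero =>
      intro u hu s
      rw [add_zero] at hu
      rw [hu, hWH]
      simp
    | succ k ih =>
      intro u hu s
      have h := ih (u + 1) (by omega)
      have hrew := hr.integral_step_mem π (by omega : u < H) s
      rw [hW u (by omega), integral_return_eq hr π 1 _ (by omega), one_mul]
      constructor
      · exact add_nonneg hrew.1 (Finset.sum_nonneg fun s'' _ =>
          mul_nonneg (transProb_nonneg _ _ _ _ _) (h s'').1)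
      · have h2 : ∑ s', transProb M π u s s' * W (u + 1) s' ≤ k * Rmax := by
          calc _ ≤ ∑ s', transProb M π u s s' * (k * Rmax) :=
                Finset.sum_le_sum fun s'' _ =>
                  mul_le_mul_of_nonneg_left (h s'').2 (transProb_nonneg _ _ _ _ _)
            _ = k * Rmax := by rw [← Finset.sum_mul, sum_transProb, one_mul]
        push_cast
        linarith [hrew.2]
  let bad : Set (Fin n → Traj S A H) := {D | ¬∀ t : Fin H, Good M π μ t D}
  have hbad : MeasurableSet bad := by
    have : bad = (⋂ t : Fin H, {D | Good M π μ t D})ᶜ := by ext D; simp [bad]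
    rw [this]
    exact (MeasurableSet.iInter fun t => measurableSet_good M π μ t).compl
  have hpt : ∀ D : Fin n → Traj S A H, sqError M π μ H n Rmax D ≤
      goodEst M π μ 1 (value M π H) W (Fin.last H) D ^ 2 +
        bad.indicator (fun _ => (H * Rmax) ^ 2) D := fun D => by
    by_cases hD : ∀ t : Fin H, Good M π μ t D
    · refine (sqError_le_sq hr D).trans ?_
      have h2 := partialEst_eq_add_sum 1 W (Fin.last H) (M := M) (π := π) (μ := μ) (D := D)
        fun u _ => hD u
      have h3 : partialEst π μ 1 W (Fin.last H) D = misEstimator π μ D := by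
        simp [partialEst, misEstimator, hWH, Fin.castSucc_lt_last]
      have h4 : partialEst π μ 1 W 0 D = ∑ s, distHat π μ D 0 s * W 0 s := by
        simp [partialEst]
      have h5 : goodEst M π μ 1 (value M π H) W (Fin.last H) D =
          misEstimator π μ D - value M π H := by
        rw [← h3, h2, h4, goodEst]; ring
      rw [h5]
      exact le_add_of_nonneg_right (Set.indicator_nonneg (fun _ _ => sq_nonneg _) _)
    · rw [Set.indicator_of_mem (show D ∈ bad from hD)]
      exact (sqError_le hr D).trans (le_add_of_nonneg_left (sq_nonneg _))
  have hgi := (memLp_goodEst (n := n) hr hw 1 (value M π H) W (Fin.last H)).integrable_sq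
  have hbi : Integrable (bad.indicator fun _ => (H * Rmax) ^ 2) (dataLaw M μ H n) :=
    (integrable_const _).indicator hbad
  refine (integral_mono (integrable_sqError hr) (hgi.add hbi) hpt).trans ?_
  rw [integral_add' hgi hbi, integral_indicator_const _ hbad, smul_eq_mul]
  refine add_le_add ?_ (mul_le_mul_of_nonneg_right (real_not_good_le hw hs hn) (sq_nonneg _))
  refine (integral_goodEst_sq_le hr hw hn 1 (value M π H) W (Fin.last H)
    fun t _ s => hW t t.isLt s).trans ?_
  have h0 : ∑ s, stateDist M μ 0 s * W 0 s = value M π H := hval.symm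
  rw [h0, sub_self, zero_pow two_ne_zero, zero_add]
  refine add_le_add ?_ ?_
  · refine div_le_div_of_nonneg_right ?_ hn0.le
    calc _ ≤ ∑ s, stateDist M μ 0 s * (H * Rmax) ^ 2 := by
          refine Finset.sum_le_sum fun s _ => mul_le_mul_of_nonneg_left ?_
            (stateDist_nonneg _ _ _ _)
          have := hW01 H 0 (by simp) s
          exact pow_le_pow_left₀ this.1 this.2 2
      _ = _ := by rw [← Finset.sum_mul, sum_stateDist, one_mul]
  · rw [Finset.sum_mul]
    refine Finset.sum_le_sum fun t _ => ?_
    rw [if_pos t.castSucc_lt_last, Finset.sum_mul]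
    refine Finset.sum_le_sum fun s _ => ?_
    rw [mul_assoc]
    refine mul_le_mul_of_nonneg_left ?_ (meanSqDiv_nonneg M π μ n t s)
    have hR := hr.Rmax_nonneg t.isLt s₀ a₀
    have htH : (t : ℕ) + 1 ≤ H := t.isLt
    -- With `H - t - 1` steps to go after the current one, the current mean reward plus the
    -- remaining value is at most `H * Rmax`.
    have h := hW01 (H - (t + 1)) (t + 1) (by omega)
    refine returnSq_one_le hr hw t.isLt s (fun s' => (h s').1) fun s' => ?_
    have h1 : ((H - (t + 1) : ℕ) : ℝ) + 1 ≤ H := by exact_mod_cast (by omega : H - (t + 1) + 1 ≤ H)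
    nlinarith [(h s').2]

/-- The constant is `8 = 1 + 6 + 1`, one summand for each term of `mse_le`; `1 ≤ X` lets the outer
two be absorbed. -/
theorem mse_le_of_sum_le (hr : BoundedRewards M H Rmax σ) (hw : BoundedWeights π μ H)
    (hs : SampleSize M π μ H n) (hn : 1 ≤ n) {X : ℝ} (hX : 1 ≤ X)
    (h : ∀ t : Fin H, ∑ s, meanSqDiv M π μ n t s * meanWeight π μ t s ≤ 6 * X / n) :
    mse M π μ H n Rmax ≤ 8 * (H * X * (σ ^ 2 + (H : ℝ) ^ 2 * Rmax ^ 2) / n) := by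
  have hn0 : (0 : ℝ) < n := by positivity
  refine (mse_le hr hw hs hn).trans ?_
  have h1 : ∑ t : Fin H, ∑ s, meanSqDiv M π μ n t s * meanWeight π μ t s ≤ H * (6 * X / n) := by
    refine (Finset.sum_le_sum fun t _ => h t).trans (le_of_eq ?_)
    simp
  have h2 : (H * Rmax) ^ 2 ≤ H * (H * Rmax) ^ 2 := by
    rcases Nat.eq_zero_or_pos H with rfl | hH
    · simp
    · exact le_mul_of_one_le_left (sq_nonneg _) (by exact_mod_cast hH)
  have h3 : H * (H * Rmax) ^ 2 ≤ H * X * (σ ^ 2 + (H * Rmax) ^ 2) := by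
    rw [mul_assoc]
    refine mul_le_mul_of_nonneg_left ?_ H.cast_nonneg
    nlinarith [sq_nonneg σ, sq_nonneg (H * Rmax)]
  calc _ ≤ H * X * (σ ^ 2 + (H * Rmax) ^ 2) / n +
        H * (6 * X / n) * (σ ^ 2 + (H * Rmax) ^ 2) + H * X * (σ ^ 2 + (H * Rmax) ^ 2) / n := by
        refine add_le_add (add_le_add ?_ ?_) ?_
        · exact div_le_div_of_nonneg_right (h2.trans h3) hn0.le
        · exact mul_le_mul_of_nonneg_right h1 (by positivity)
        · rw [div_mul_eq_mul_div]
          exact div_le_div_of_nonneg_right h3 hn0.le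
    _ = _ := by ring

theorem sum_meanSqDiv_mul_le (hr : BoundedRewards M H Rmax σ) (hw : BoundedWeights π μ H)
    (hs : SampleSize M π μ H n) (hn : 1 ≤ n) (t : Fin H) :
    ∑ s, meanSqDiv M π μ n t s * meanWeight π μ t s ≤ 6 * (tauA π μ H * tauS M π μ H) / n := by
  have hn0 : (0 : ℝ) < n := by positivity
  have := M.nonempty_state
  have hA := one_le_tauA hw t.pos
  have hS := one_le_tauS (M := M) hw t.pos
  calc _ ≤ ∑ s, (2 / n * (2 * (tauS M π μ H * stateDist M π t s))) * tauA π μ H := by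
        refine Finset.sum_le_sum fun s _ => ?_
        have h1 : meanSqDiv M π μ n t s ≤ 2 / n * (2 * (tauS M π μ H * stateDist M π t s)) :=
          (meanSqDiv_le hr hw hs hn t s).trans
            (mul_le_mul_of_nonneg_left (add_max_le hw t.isLt s) (by positivity))
        exact mul_le_mul h1 (meanWeight_le_tauA hw t.isLt s) (meanWeight_nonneg _ _ _ _)
          ((meanSqDiv_nonneg M π μ n t s).trans h1)
    _ = 4 * (tauA π μ H * tauS M π μ H) / n * ∑ s, stateDist M π t s := by
        rw [Finset.mul_sum]
        exact Finset.sum_congr rfl fun s _ => by ring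
    _ ≤ _ := by
        rw [sum_stateDist, mul_one]
        gcongr
        norm_num

/-! ### Finite action spaces with uniform coverage -/

theorem sum_dens [Fintype A] [MeasurableSingletonClass A] (hν : ν = Measure.count)
    (p : Policy S A ν) (t : ℕ) (s : S) : ∑ a, p.dens t s a = 1 := by
  have h := p.lintegral_dens t s
  subst hν
  rw [lintegral_count, tsum_fintype, ← ENNReal.ofReal_sum_of_nonneg fun a _ => p.dens_nonneg _ _ _,
    ENNReal.ofReal_eq_one] at h
  exact h

/-- Summing the coverage condition over all state-action pairs forces `c ≤ 1`. -/
theorem one_le_card_mul_div [Fintype A] [MeasurableSingletonClass A] (hν : ν = Measure.count)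
    (M : EpisodicMDP S A) (μ : Policy S A ν) {c : ℝ} (hc : 0 < c) {t : ℕ}
    (h : ∀ s a, c / (Fintype.card S * Fintype.card A) ≤ stateDist M μ t s * μ.dens t s a) :
    1 ≤ (Fintype.card S * Fintype.card A : ℝ) / c := by
  have hS := M.nonempty_state
  have hA := μ.nonempty_action hS.some
  have hS0 : (0 : ℝ) < Fintype.card S := by exact_mod_cast Fintype.card_pos
  have hA0 : (0 : ℝ) < Fintype.card A := by exact_mod_cast Fintype.card_pos
  rw [one_le_div hc]
  have h1 : ∑ _s : S, ∑ _a : A, c / (Fintype.card S * Fintype.card A : ℝ) ≤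
      ∑ s, ∑ a, stateDist M μ t s * μ.dens t s a :=
    Finset.sum_le_sum fun s _ => Finset.sum_le_sum fun a _ => h s a
  have h2 : ∑ s, ∑ a, stateDist M μ t s * μ.dens t s a = 1 := by
    simp_rw [← Finset.mul_sum, sum_dens hν, mul_one, sum_stateDist]
  rw [h2] at h1
  simp only [Finset.sum_const, Finset.card_univ, nsmul_eq_mul] at h1
  have h3 : (Fintype.card S : ℝ) * (Fintype.card A * (c / (Fintype.card S * Fintype.card A))) = c := by
    field_simp
  rw [h3] at h1
  have h4 : (1 : ℝ) ≤ Fintype.card S := by exact_mod_cast Fintype.card_pos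
  have h5 : (1 : ℝ) ≤ Fintype.card A := by exact_mod_cast Fintype.card_pos
  nlinarith

/-- Bounding by `τ_a τ_s` would lose here. Coverage gives `π / μ ≤ X q π`, whose factor `q` cancels
the `1 / q` in `p² / q`; what remains sums to a multiple of `X`. -/
theorem sum_meanSqDiv_mul_le_card [Fintype A] [MeasurableSingletonClass A]
    (hν : ν = Measure.count) (hr : BoundedRewards M H Rmax σ) (hw : BoundedWeights π μ H)
    (hs : SampleSize M π μ H n) (hn : 1 ≤ n) (t : Fin H) {X : ℝ} (hX : 0 < X)
    (h : ∀ s a, 1 / X ≤ stateDist M μ t s * μ.dens t s a) :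
    ∑ s, meanSqDiv M π μ n t s * meanWeight π μ t s ≤ 6 * X / n := by
  have hn0 : (0 : ℝ) < n := by positivity
  have hkey : ∀ s, (stateDist M π t s ^ 2 / stateDist M μ t s + max
      (stateDist M π t s ^ 2 / stateDist M μ t s) (stateDist M π t s)) * meanWeight π μ t s ≤
        3 * X * stateDist M π t s := fun s => by
    set p := stateDist M π t s with hp
    set q := stateDist M μ t s with hq
    have hp0 : 0 ≤ p := stateDist_nonneg _ _ _ _
    have hp1 : p ≤ 1 := stateDist_le_one _ _ _ _
    have hq0 : 0 ≤ q := stateDist_nonneg _ _ _ _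
    have hq1 : q ≤ 1 := stateDist_le_one _ _ _ _
    -- Applied below with `y = p² / q` and `y = p`; the former occurs twice in the bound, whence the
    -- factor `3`.
    have h1 : ∀ y, 0 ≤ y → y * q ≤ p → y * meanWeight π μ t s ≤ X * p := fun y hy0 hy => by
      rw [meanWeight_eq_sum hν, Finset.mul_sum]
      calc _ ≤ ∑ a, X * p * π.dens t s a := by
            refine Finset.sum_le_sum fun a _ => ?_
            have ha0 := π.dens_nonneg t s a
            have ha1 : π.dens t s a ≤ 1 := by
              rw [← sum_dens hν π t s]
              exact Finset.single_le_sum (fun a _ => π.dens_nonneg t s a) (Finset.mem_univ a)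
            have h2 : 0 < q * μ.dens t s a := (one_div_pos.2 hX).trans_le (h s a)
            have hμ0 : 0 < μ.dens t s a := pos_of_mul_pos_right h2 hq0
            have hw' : weight π μ t s a ≤ X * q * π.dens t s a := by
              rw [weight, div_le_iff₀ hμ0]
              have h3 := h s a
              rw [div_le_iff₀ hX] at h3
              have h4 := mul_le_mul_of_nonneg_right h3 ha0
              linarith
            have hw0 := weight_nonneg π μ t s a
            calc y * (π.dens t s a * weight π μ t s a)
                ≤ y * (1 * (X * q * π.dens t s a)) := by gcongr
              _ = X * (y * q) * π.dens t s a := by ring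
              _ ≤ X * p * π.dens t s a := by gcongr
        _ = X * p := by rw [← Finset.mul_sum, sum_dens hν, mul_one]
    have hR := h1 (p ^ 2 / q) (by positivity) (by
      rcases hq0.eq_or_lt with h0 | h0
      · rw [← h0, mul_zero]; exact hp0
      · rw [div_mul_cancel₀ _ h0.ne']; nlinarith)
    have hP := h1 p hp0 (mul_le_of_le_one_right hp0 hq1)
    have hm : max (p ^ 2 / q) p ≤ p ^ 2 / q + p :=
      max_le (le_add_of_nonneg_right hp0) (le_add_of_nonneg_left (by positivity))
    have hmw := meanWeight_nonneg π μ t s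
    calc _ ≤ (p ^ 2 / q + (p ^ 2 / q + p)) * meanWeight π μ t s := by gcongr
      _ = p ^ 2 / q * meanWeight π μ t s + (p ^ 2 / q * meanWeight π μ t s +
          p * meanWeight π μ t s) := by ring
      _ ≤ X * p + (X * p + X * p) := by gcongr
      _ = _ := by ring
  calc _ ≤ ∑ s, 2 / n * (3 * X * stateDist M π t s) := by
        refine Finset.sum_le_sum fun s _ => ?_
        refine (mul_le_mul_of_nonneg_right (meanSqDiv_le hr hw hs hn t s)
          (meanWeight_nonneg _ _ _ _)).trans ?_
        rw [mul_assoc]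
        exact mul_le_mul_of_nonneg_left (hkey s) (by positivity)
    _ = _ := by
        rw [← Finset.mul_sum, ← Finset.mul_sum, sum_stateDist]
        ring

/-! ### Assembly of the three bounds -/

theorem add_sq_mul_le (σ R : ℝ) (H : ℕ) :
    H * (σ ^ 2 + (H : ℝ) ^ 2 * R ^ 2) ≤ (H : ℝ) ^ 3 * (σ ^ 2 + R ^ 2) := by
  rcases Nat.eq_zero_or_pos H with rfl | hH
  · simp
  · have h1 : (1 : ℝ) ≤ H := by exact_mod_cast hH
    have h2 : (H : ℝ) ≤ H ^ 3 := le_self_pow₀ h1 (by norm_num)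
    nlinarith [mul_le_mul_of_nonneg_right h2 (sq_nonneg σ)]

theorem mse_le_tau (hr : BoundedRewards M H Rmax σ) (hw : BoundedWeights π μ H)
    (hs : SampleSize M π μ H n) (hn : 1 ≤ n) :
    mse M π μ H n Rmax ≤ 8 * (H * (tauA π μ H * tauS M π μ H) *
      (σ ^ 2 + (H : ℝ) ^ 2 * Rmax ^ 2) / n) := by
  rcases Nat.eq_zero_or_pos H with rfl | hH
  · have := mse_le_of_sum_le hr hw hs hn le_rfl fun t => t.elim0
    simpa using this
  · have := M.nonempty_state
    exact mse_le_of_sum_le hr hw hs hn (one_le_mul_of_one_le_of_one_le (one_le_tauA hw hH)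
      (one_le_tauS (M := M) hw hH)) fun t => sum_meanSqDiv_mul_le hr hw hs hn t

theorem tauA_nonneg (π μ : Policy S A ν) (H : ℕ) : 0 ≤ tauA π μ H :=
  Real.iSup_nonneg fun _ => weight_nonneg _ _ _ _ _

theorem tauS_nonneg (M : EpisodicMDP S A) (π μ : Policy S A ν) (H : ℕ) : 0 ≤ tauS M π μ H :=
  Real.iSup_nonneg fun _ => div_nonneg (stateDist_nonneg _ _ _ _) (stateDist_nonneg _ _ _ _)

theorem mse_le_sq_of_le [Fintype A] [MeasurableSingletonClass A] (hν : ν = Measure.count)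
    (hr : BoundedRewards M H Rmax σ) (hw : BoundedWeights π μ H) (hs : SampleSize M π μ H n)
    (hn : 1 ≤ n) {c : ℝ} (hc : 0 < c)
    (h : ∀ t < H, ∀ s a, c / (Fintype.card S * Fintype.card A) ≤
      stateDist M μ t s * μ.dens t s a) {ε : ℝ} (hε : 0 < ε)
    (hnε : 8 * ((H : ℝ) ^ 3 * Fintype.card S * Fintype.card A * (σ ^ 2 + Rmax ^ 2) /
      (c * ε ^ 2)) ≤ n) :
    mse M π μ H n Rmax ≤ ε ^ 2 := by
  have hn0 : (0 : ℝ) < n := by positivity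
  rcases Nat.eq_zero_or_pos H with rfl | hH
  · have := mse_le_tau hr hw hs hn
    simp only [CharP.cast_eq_zero, zero_mul, zero_div, mul_zero] at this
    exact this.trans (sq_nonneg ε)
  · set X : ℝ := (Fintype.card S * Fintype.card A : ℝ) / c with hX
    have hX1 : 1 ≤ X := one_le_card_mul_div hν M μ hc (h 0 hH)
    have hX0 : 0 < X := zero_lt_one.trans_le hX1
    refine (mse_le_of_sum_le hr hw hs hn hX1 fun t =>
      sum_meanSqDiv_mul_le_card hν hr hw hs hn t hX0 fun s a => ?_).trans ?_
    · rw [hX, one_div_div]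
      exact h t t.isLt s a
    · have h1 : 8 * ((H : ℝ) ^ 3 * Fintype.card S * Fintype.card A * (σ ^ 2 + Rmax ^ 2) /
          (c * ε ^ 2)) = 8 * (X * ((H : ℝ) ^ 3 * (σ ^ 2 + Rmax ^ 2))) / ε ^ 2 := by
        rw [hX]; field_simp
      rw [h1, div_le_iff₀ (by positivity)] at hnε
      rw [mul_div_assoc', div_le_iff₀ hn0]
      have h2 := mul_le_mul_of_nonneg_left (add_sq_mul_le σ Rmax H) hX0.le
      linarith

end Main

end MIS

end

theorem mainTheorem3 :
    ∃ C : ℝ, 0 < C ∧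
      ∀ (S : Type*) (A : Type*) [Fintype S] [MeasurableSpace S] [DiscreteMeasurableSpace S]
        [MeasurableSpace A] (ν : Measure A) (M : MIS.EpisodicMDP S A) (π μ : MIS.Policy S A ν)
        (H n : ℕ) (Rmax σ : ℝ),
        1 ≤ n → MIS.BoundedRewards M H Rmax σ → MIS.BoundedWeights π μ H →
        MIS.SampleSize M π μ H n →
          Integrable (MIS.sqError M π μ H n Rmax) (MIS.dataLaw M μ H n) ∧
          MIS.mse M π μ H n Rmax ≤
            C * (H * (MIS.tauA π μ H * MIS.tauS M π μ H + MIS.tauA π μ H) *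
              (σ ^ 2 + (H : ℝ) ^ 2 * Rmax ^ 2) / n) ∧
          MIS.mse M π μ H n Rmax ≤
            C * ((H : ℝ) ^ 3 * MIS.tauA π μ H * MIS.tauS M π μ H * (σ ^ 2 + Rmax ^ 2) / n) ∧
          ∀ [Fintype A] [MeasurableSingletonClass A], ν = Measure.count →
            ∀ c : ℝ, 0 < c →
              (∀ t < H, ∀ s a, c / (Fintype.card S * Fintype.card A) ≤
                MIS.stateDist M μ t s * μ.dens t s a) →
              ∀ ε : ℝ, 0 < ε →
                C * ((H : ℝ) ^ 3 * Fintype.card S * Fintype.card A * (σ ^ 2 + Rmax ^ 2) /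
                  (c * ε ^ 2)) ≤ n →
                MIS.mse M π μ H n Rmax ≤ ε ^ 2 := by
  refine ⟨8, by norm_num, ?_⟩
  intro S A _ _ _ _ ν M π μ H n Rmax σ hn hr hw hs
  have hA := MIS.tauA_nonneg π μ H
  have hS := MIS.tauS_nonneg M π μ H
  have h := MIS.mse_le_tau hr hw hs hn
  refine ⟨MIS.integrable_sqError hr, h.trans ?_, h.trans ?_, ?_⟩
  -- The bound with `τ_a τ_s` alone is already stronger; the extra `τ_a` is only added.
  · gcongr
    exact le_add_of_nonneg_right hA
  · have h1 := mul_le_mul_of_nonneg_left (MIS.add_sq_mul_le σ Rmax H) (mul_nonneg hA hS)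
    refine mul_le_mul_of_nonneg_left (div_le_div_of_nonneg_right ?_ n.cast_nonneg) (by norm_num)
    linarith
  · intro _ _ hν c hc hcov ε hε hnε
    exact MIS.mse_le_sq_of_le hν hr hw hs hn hc hcov hε hnε
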